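/- Let $\mathbb F$ be a field of characteristic $0$; all tensor products are over $\mathbb F$. Let $\mathcal V$ be a differential algebra, that is, a unital associative (not necessarily commutative) $\mathbb F$-algebra with a derivation $\partial$; $\partial$ acts on tensor powers of $\mathcal V$ as a derivation. A *2-fold $\lambda$-bracket* on $\mathcal V$ is an $\mathbb F$-bilinear map $\mathcal V\times\mathcal V\to(\mathcal V\otimes\mathcal V)[\lambda]$, $(a,b)\mapsto\{\!\!\{a_\lambda b\}\!\!\}$, such that $$\{\!\!\{\partial a_\lambda b\}\!\!\}=-\lambda\{\!\!\{a_\lambda b\}\!\!\},\qquad \{\!\!\{a_\lambda\partial b\}\!\!\}=(\lambda+\partial)\{\!\!\{a_\lambda b\}\!\!\},\qquad \{\!\!\{a_\lambda bc\}\!\!\}=\{\!\!\{a_\lambda b\}\!\!\}c+b\{\!\!\{a_\lambda c\}\!\!\},$$ $$\{\!\!\{ab_\lambda c\}\!\!\}=\sum_k g_k'\big((\lambda+\partial)^k b\big)\otimes g_k''+\sum_k h_k'\otimes\big((\lambda+\partial)^k a\big)h_k'',$$ where $x(f\otimes g)y=xf\otimes gy$, $\{\!\!\{a_\lambda c\}\!\!\}=\sum_k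 (g_k'\otimes g_k'')\lambda^k$ and $\{\!\!\{b_\lambda c\}\!\!\}=\sum_k (h_k'\otimes h_k'')\lambda^k$. It is a *double PVA (Poisson vertex algebra) $\lambda$-bracket* if moreover, for all $a,b,c$, $$\{\!\!\{a_\lambda b\}\!\!\}=-\{\!\!\{b_{-\lambda-\partial}a\}\!\!\}^\sigma,\qquad \{\!\!\{a_\lambda\{\!\!\{b_\mu c\}\!\!\}\}\!\!\}_L-\{\!\!\{b_\mu\{\!\!\{a_\lambda c\}\!\!\}\}\!\!\}_R=\{\!\!\{\{\!\!\{a_\lambda b\}\!\!\}_{\lambda+\mu}c\}\!\!\}_L ,$$ where $-\lambda-\partial$ is moved to the left and acts on the coefficients, $(f\otimes g)^\sigma=g\otimes f$, $\{\!\!\{a_\lambda (f\otimes g)\}\!\!\}_L=\{\!\!\{a_\lambda f\}\!\!\}\otimes g$, $\{\!\!\{a_\lambda (f\otimes g)\}\!\!\}_R=f\otimes\{\!\!\{a_\lambda g\}\!\!\}$, and $\{\!\!\{(f\otimes g)_\lambda c\}\!\!\}_L=\sum_k p_k'\otimes\big((\lambda+\partial)^k g\big)\otimes p_k''$ if $\{\!\!\{f_\lambda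 c\}\!\!\}=\sum_k(p_k'\otimes p_k'')\lambda^k$. Let $\{\!\!\{-_\lambda-\}\!\!\}$ be a 2-fold $\lambda$-bracket on $\mathcal V$ and let $L(\partial)=\sum_{n\le N}a_n\partial^n\in\mathcal V((\partial^{-1}))$ be a pseudodifferential operator, with symbol $L(z)=\sum_n a_nz^n$ and formal adjoint $L^*(\partial)=\sum_n(-\partial)^n\circ a_n$, whose symbol is $L^*(z)=\sum_n(-z-\partial)^n a_n$ expanded for large $z$. $L(\partial)$ is *of Adler type* if $$\{\!\!\{L(z)_\lambda L(w)\}\!\!\}=L(z)\otimes i_z(z-w-\lambda-\partial)^{-1}L(w)-L(w+\lambda+\partial)\otimes i_z(z-w-\lambda-\partial)^{-1}L^*(-z+\lambda)$$ (equality of the coefficients in $(\mathcal V\otimes\mathcal V)[\lambda]$ of all $z^pw^q$, $p,q\in\mathbb Z$). Here $i_z(z-w-\lambda-\partial)^{-1}=\sum_{k\ge0}z^{-k-1}(w+\lambda+\partial)^k$, powers of $w+\lambda+\partial$ are expanded in non-negative powers of $\lambda+\partial$, powers of $-z+\lambda$ in non-negative powers of $\lambda$, and $\partial$ acts to the right,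 i.e. $L(w+\lambda+\partial)\otimes X=\sum_n a_n\otimes(w+\lambda+\partial)^nX$. **Theorem.** Let $\mathcal U\subset\mathcal V$ be the differential subalgebra generated by the coefficients of $L(\partial)$, i.e. the smallest unital $\partial$-stable subalgebra containing all $a_n$. If $L(\partial)$ is of Adler type, then $\{\!\!\{-_\lambda-\}\!\!\}$ restricts to a double PVA $\lambda$-bracket on $\mathcal U$: for $a,b\in\mathcal U$ one has $\{\!\!\{a_\lambda b\}\!\!\}\in(\mathcal U\otimes\mathcal U)[\lambda]$, and the resulting map on $\mathcal U$ is a double PVA $\lambda$-bracket. -/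

import Mathlib

open scoped TensorProduct

noncomputable section

namespace DoublePVA

/-! ## Polynomials in formal variables with coefficients in a vector space

`PolynomialModule F M` is the space `M[λ]`, with `(Polynomial.X : F[X])` acting as multiplication by `λ`.
The space `M[λ, μ]` is `(M[λ])[μ]`, i.e. `PolynomialModule F (PolynomialModule F M)`. -/

section Poly

variable {F : Type*} [Field F]
variable {M : Type*} [AddCommGroup M] [Module F M]
variable {N : Type*} [AddCommGroup N] [Module F N]
variable {P : Type*} [AddCommGroup P] [Module F P]

variable (F M) in
/-- Multiplication by the variable on `M[λ]`. -/
def mulVar : Module.End F (PolynomialModule F M) :=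
  Algebra.lsmul F F (PolynomialModule F M) (Polynomial.X : Polynomial F)

/-- For `D : M → M`, the operator `λ + D` on `M[λ]`, where `D` acts on the coefficients. -/
def varAdd (D : Module.End F M) : Module.End F (PolynomialModule F M) :=
  mulVar F M + PolynomialModule.map F D

/-- Substitution of an operator `T` for the variable, powers of `T` being put on the left:
`∑ xₖ λᵏ ↦ ∑ Tᵏ (ι xₖ)`. -/
def subst (T : Module.End F N) (ι : M →ₗ[F] N) : PolynomialModule F M →ₗ[F] N :=
  (Finsupp.lsum F fun k : ℕ => (T ^ k) ∘ₗ ι) ∘ₗ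
    (PolynomialModule.coeffLinearEquiv F F (M := M)).toLinearMap

theorem map_add_map (f g : M →ₗ[F] N) :
    PolynomialModule.map F (f + g) = PolynomialModule.map F f + PolynomialModule.map F g := by
  ext k x : 2
  simp

theorem map_smul_map (c : F) (f : M →ₗ[F] N) :
    PolynomialModule.map F (c • f) = c • PolynomialModule.map F f := by
  ext k x : 2
  simp

/-- `f ↦ (f` applied to the coefficients`)`, as a linear map `Hom(M, N) → Hom(M[λ], N[λ])`. -/
def mapHom : (M →ₗ[F] N) →ₗ[F] (PolynomialModule F M →ₗ[F] PolynomialModule F N) where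
  toFun f := PolynomialModule.map F f
  map_add' := map_add_map
  map_smul' := map_smul_map

/-- The arrow notation: for a polynomial `p(λ) = ∑ hₖ λᵏ`, an element `b` and a bilinear
product `β`, this is `∑ β (hₖ, (λ + D)ᵏ b)`, where `D` acts on `b` only. -/
def arrow (D : Module.End F M) (β : P →ₗ[F] M →ₗ[F] N) :
    PolynomialModule F P →ₗ[F] M →ₗ[F] PolynomialModule F N :=
  (Finsupp.lsum F fun k : ℕ =>
      (LinearMap.lcomp F (PolynomialModule F N)
        ((varAdd D ^ k) ∘ₗ (PolynomialModule.lsingle F 0 : M →ₗ[F] PolynomialModule F M))) ∘ₗ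
      mapHom ∘ₗ β) ∘ₗ
    (PolynomialModule.coeffLinearEquiv F F (M := P)).toLinearMap

theorem arrow_apply (D : Module.End F M) (β : P →ₗ[F] M →ₗ[F] N)
    (p : PolynomialModule F P) (b : M) :
    arrow D β p b = p.coeff.sum fun k h =>
      PolynomialModule.map F (β h) ((varAdd D ^ k) (PolynomialModule.single F 0 b)) := by
  simp only [arrow, LinearMap.comp_apply, LinearEquiv.coe_coe,
    PolynomialModule.coeffLinearEquiv_apply, Finsupp.lsum_apply, Finsupp.sum,
    LinearMap.sum_apply]
  rfl

variable (F M) in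
/-- Multiplication by `λ` on `M[λ, μ] = (M[λ])[μ]`. -/
def mulLam : Module.End F (PolynomialModule F (PolynomialModule F M)) :=
  PolynomialModule.map F (mulVar F M)

variable (F M) in
/-- Multiplication by `μ` on `M[λ, μ] = (M[λ])[μ]`. -/
def mulMu : Module.End F (PolynomialModule F (PolynomialModule F M)) :=
  mulVar F (PolynomialModule F M)

variable (F M) in
/-- The inclusion `M[μ] ⊆ M[λ, μ]`. -/
def inclMu : PolynomialModule F M →ₗ[F] PolynomialModule F (PolynomialModule F M) :=
  PolynomialModule.map F (PolynomialModule.lsingle F 0)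

variable (F M) in
/-- `p(ν) ↦ p(λ + μ)`, as a map `M[ν] → M[λ, μ]`. -/
def evalLamAddMu : PolynomialModule F M →ₗ[F] PolynomialModule F (PolynomialModule F M) :=
  subst (mulLam F M + mulMu F M) (PolynomialModule.lsingle F 0 ∘ₗ PolynomialModule.lsingle F 0)

end Poly

/-! ## Differential algebras -/

/-- A derivation of a unital associative, not necessarily commutative, algebra.
A differential algebra is an algebra `V` together with `d : NCDerivation F V`. -/
structure NCDerivation (F V : Type*) [Field F] [Ring V] [Algebra F V] extends V →ₗ[F] V where
  leibniz' : ∀ a b : V, toFun (a * b) = toFun a * b + a * toFun b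

section Bracket

variable {F V : Type*} [Field F] [Ring V] [Algebra F V]

/-- `∂` on `V ⊗ V`: `∂ (a ⊗ b) = ∂ a ⊗ b + a ⊗ ∂ b`. -/
def NCDerivation.tensor (d : NCDerivation F V) : Module.End F (V ⊗[F] V) :=
  TensorProduct.map d.toLinearMap LinearMap.id + TensorProduct.map LinearMap.id d.toLinearMap

variable (F V) in
/-- The product `(a ⊗ b) ⋆₁ x = a x ⊗ b`, as a bilinear map of `a ⊗ b` and `x`. -/
def starOneRight : V ⊗[F] V →ₗ[F] V →ₗ[F] V ⊗[F] V :=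
  (LinearMap.mul F (V ⊗[F] V)).compl₂
    (Algebra.TensorProduct.includeLeft : V →ₐ[F] V ⊗[F] V).toLinearMap

theorem starOneRight_tmul (a b x : V) :
    starOneRight F V (a ⊗ₜ[F] b) x = (a * x) ⊗ₜ[F] b := by
  simp [starOneRight]

variable (F V) in
/-- The product `x ⋆₁ (a ⊗ b) = a ⊗ x b`, as a bilinear map of `a ⊗ b` and `x`. -/
def starOneLeft : V ⊗[F] V →ₗ[F] V →ₗ[F] V ⊗[F] V :=
  (LinearMap.mul F (V ⊗[F] V)).flip.compl₂
    (Algebra.TensorProduct.includeRight : V →ₐ[F] V ⊗[F] V).toLinearMap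

theorem starOneLeft_tmul (a b x : V) :
    starOneLeft F V (a ⊗ₜ[F] b) x = a ⊗ₜ[F] (x * b) := by
  simp [starOneLeft]

variable (F V) in
/-- The outer left action `x (a ⊗ b) = x a ⊗ b`. -/
def outerLeft (x : V) : V ⊗[F] V →ₗ[F] V ⊗[F] V :=
  TensorProduct.map (LinearMap.mulLeft F x) LinearMap.id

variable (F V) in
/-- The outer right action `(a ⊗ b) x = a ⊗ b x`. -/
def outerRight (x : V) : V ⊗[F] V →ₗ[F] V ⊗[F] V :=
  TensorProduct.map LinearMap.id (LinearMap.mulRight F x)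

/-- A `2`-fold `λ`-bracket on the differential algebra `(V, d)`: a bilinear map `br`, with
`br a b = {{a_λ b}} ∈ (V ⊗ V)[λ]`, satisfying sesquilinearity and both Leibniz rules. -/
structure LambdaBracket (d : NCDerivation F V) where
  br : V →ₗ[F] V →ₗ[F] PolynomialModule F (V ⊗[F] V)
  /-- `{{∂a_λ b}} = -λ {{a_λ b}}` -/
  sesqui_left : ∀ a b : V, br (d.toLinearMap a) b = -mulVar F (V ⊗[F] V) (br a b)
  /-- `{{a_λ ∂b}} = (λ + ∂) {{a_λ b}}` -/
  sesqui_right : ∀ a b : V, br a (d.toLinearMap b) = varAdd d.tensor (br a b)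
  /-- `{{a_λ bc}} = {{a_λ b}} c + b {{a_λ c}}` -/
  leibniz_right : ∀ a b c : V, br a (b * c) =
    PolynomialModule.map F (outerRight F V c) (br a b) +
      PolynomialModule.map F (outerLeft F V b) (br a c)
  /-- `{{ab_λ c}} = {{a_{λ+∂} c}}_→ ⋆₁ b + (e^{∂ ∂_λ} a) ⋆₁ {{b_λ c}}` -/
  leibniz_left : ∀ a b c : V, br (a * b) c =
    arrow d.toLinearMap (starOneRight F V) (br a c) b +
      arrow d.toLinearMap (starOneLeft F V) (br b c) a

variable (F V) in
/-- `(a ⊗ b) ⊗₁ x = a ⊗ x ⊗ b`, as a bilinear map of `a ⊗ b` and `x`. -/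
def insertMid : V ⊗[F] V →ₗ[F] V →ₗ[F] V ⊗[F] (V ⊗[F] V) :=
  (LinearMap.lTensorHom V ∘ₗ TensorProduct.mk F V V).flip

theorem insertMid_tmul (a b x : V) :
    insertMid F V (a ⊗ₜ[F] b) x = a ⊗ₜ[F] (x ⊗ₜ[F] b) := by
  simp [insertMid]

variable (F V) in
/-- `y ↦ ((a ⊗ b) ↦ a ⊗ b ⊗ y)`. -/
def appendRight : V →ₗ[F] V ⊗[F] V →ₗ[F] V ⊗[F] (V ⊗[F] V) :=
  LinearMap.lTensorHom V ∘ₗ (TensorProduct.mk F V V).flip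

theorem appendRight_tmul (a b y : V) :
    appendRight F V y (a ⊗ₜ[F] b) = a ⊗ₜ[F] (b ⊗ₜ[F] y) := by
  simp [appendRight]

namespace LambdaBracket

variable {d : NCDerivation F V} (B : LambdaBracket d)

/-- `{{a_λ (x ⊗ y)}}_L = {{a_λ x}} ⊗ y`, as a linear map of `x ⊗ y`. -/
def brL (a : V) : V ⊗[F] V →ₗ[F] PolynomialModule F (V ⊗[F] (V ⊗[F] V)) :=
  TensorProduct.lift ((mapHom ∘ₗ appendRight F V).flip ∘ₗ B.br a)

theorem brL_tmul (a x y : V) :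
    B.brL a (x ⊗ₜ[F] y) = PolynomialModule.map F (appendRight F V y) (B.br a x) := by
  simp [brL, mapHom]

/-- `{{a_λ (x ⊗ y)}}_R = x ⊗ {{a_λ y}}`, as a linear map of `x ⊗ y`. -/
def brR (a : V) : V ⊗[F] V →ₗ[F] PolynomialModule F (V ⊗[F] (V ⊗[F] V)) :=
  TensorProduct.lift ((mapHom ∘ₗ TensorProduct.mk F V (V ⊗[F] V)).compl₂ (B.br a))

theorem brR_tmul (a x y : V) :
    B.brR a (x ⊗ₜ[F] y) =
      PolynomialModule.map F (TensorProduct.mk F V (V ⊗[F] V) x) (B.br a y) := by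
  simp [brR, mapHom]

/-- `{{(x ⊗ y)_λ c}}_L = {{x_{λ+∂} c}}_→ ⊗₁ y`, as a linear map of `x ⊗ y`. -/
def brOuterL (c : V) : V ⊗[F] V →ₗ[F] PolynomialModule F (V ⊗[F] (V ⊗[F] V)) :=
  TensorProduct.lift (arrow d.toLinearMap (insertMid F V) ∘ₗ B.br.flip c)

theorem brOuterL_tmul (c x y : V) :
    B.brOuterL c (x ⊗ₜ[F] y) = arrow d.toLinearMap (insertMid F V) (B.br x c) y := by
  simp [brOuterL]

/-- The bracket makes `(V, d)` a double Poisson vertex algebra. -/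
structure IsDoublePVA : Prop where
  /-- `{{a_λ b}} = -{{b_{-λ-∂} a}}^σ`, with `-λ-∂` moved to the left and acting on coefficients. -/
  skew : ∀ a b : V, B.br a b =
    -PolynomialModule.map F (TensorProduct.comm F V V).toLinearMap
      (subst (-varAdd d.tensor) (PolynomialModule.lsingle F 0) (B.br b a))
  /-- `{{a_λ {{b_μ c}}}}_L - {{b_μ {{a_λ c}}}}_R = {{{{a_λ b}}_{λ+μ} c}}_L` in `V^{⊗3}[λ, μ]`. -/
  jacobi : ∀ a b c : V,
    PolynomialModule.map F (B.brL a) (B.br b c) -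
      subst (mulLam F _) (inclMu F _ ∘ₗ B.brR b) (B.br a c) =
    subst (mulLam F _) (evalLamAddMu F _ ∘ₗ B.brOuterL c) (B.br a b)

end LambdaBracket

end Bracket

/-! ## Pseudodifferential operators and the Adler identity -/

/-- A pseudodifferential operator `L(∂) = ∑_{n ≤ N} aₙ ∂ⁿ ∈ V((∂⁻¹))`, given by its coefficients
`aₙ = coeff n`. Its symbol is `L(z) = ∑ aₙ zⁿ`. -/
@[ext]
structure PseudoDiffOp (V : Type*) [Zero V] where
  coeff : ℤ → V
  bdd : ∃ N : ℤ, ∀ n, N < n → coeff n = 0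

section Adler

variable {F V : Type*} [Field F] [Ring V] [Algebra F V]

/-- The formal adjoint `L*(∂) = ∑ₙ (-∂)ⁿ ∘ aₙ`, whose symbol is
`L*(z) = ∑ₙ (-z-∂)ⁿ aₙ = ∑_{n, j} (-1)ⁿ (n choose j) (∂ʲ aₙ) z^{n-j}`. -/
def PseudoDiffOp.adjoint (d : NCDerivation F V) (L : PseudoDiffOp V) : PseudoDiffOp V where
  coeff p := ∑ᶠ j : ℕ, (Int.negOnePow (p + j) : ℤ) •
    Ring.choose (p + j : ℤ) j • (d.toLinearMap ^ j) (L.coeff (p + j))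
  bdd := by
    obtain ⟨N, hN⟩ := L.bdd
    refine ⟨N, fun p hp => ?_⟩
    have h : ∀ j : ℕ, L.coeff (p + j) = 0 := fun j => hN _ (by omega)
    simp [h]

/-- The coefficient of `z^q` in `L(-z+λ)`, an element of `V[λ]`; here
`(-z+λ)ᵖ = ∑ᵢ (p choose i) (-z)^{p-i} λⁱ` is expanded for large `z`. -/
def PseudoDiffOp.evalNegAdd (F : Type*) {V : Type*} [Field F] [Ring V] [Algebra F V]
    (L : PseudoDiffOp V) (q : ℤ) : PolynomialModule F V :=
  ∑ᶠ i : ℕ, (Int.negOnePow q : ℤ) •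
    Ring.choose (q + i : ℤ) i • PolynomialModule.single F i (L.coeff (q + i))

/-- For `f(w) = ∑ f_q w^q` with values in `V[λ]`, the coefficients of the series
`i_w (w+λ+∂)ⁿ f(w) = ∑_j (n choose j) w^{n-j} (λ+∂)ʲ f(w)`. -/
def shiftPow (d : NCDerivation F V) (n : ℤ) (f : ℤ → PolynomialModule F V) (q : ℤ) :
    PolynomialModule F V :=
  ∑ᶠ j : ℕ, Ring.choose n j • (varAdd d.toLinearMap ^ j) (f (q - n + j))

/-- For `f(z,w) = ∑ f_{p,q} z^p w^q` with values in `V[λ]`, the coefficients of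
`i_z (z-w-λ-∂)⁻¹ f(z,w) = ∑_{k ≥ 0} z^{-k-1} (w+λ+∂)ᵏ f(z,w)`. -/
def resolvent (d : NCDerivation F V) (f : ℤ → ℤ → PolynomialModule F V) (p q : ℤ) :
    PolynomialModule F V :=
  ∑ᶠ k : ℕ, shiftPow d (k : ℤ) (f (p + k + 1)) q

/-- `a ⊗ v(λ)` for `a ∈ V` and `v(λ) ∈ V[λ]`. -/
def tensorPoly (a : V) : PolynomialModule F V →ₗ[F] PolynomialModule F (V ⊗[F] V) :=
  PolynomialModule.map F (TensorProduct.mk F V V a)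

/-- The coefficient of `z^p w^q` in `L(z) ⊗ i_z (z-w-λ-∂)⁻¹ L(w)`. -/
def adlerFirst (d : NCDerivation F V) (L : PseudoDiffOp V) (p q : ℤ) :
    PolynomialModule F (V ⊗[F] V) :=
  ∑ᶠ n : ℤ, tensorPoly (L.coeff n)
    (resolvent d (Pi.single 0 fun m => PolynomialModule.single F 0 (L.coeff m)) (p - n) q)

/-- The coefficient of `z^p w^q` in `L(w+λ+∂) ⊗ i_z (z-w-λ-∂)⁻¹ L*(-z+λ)`. -/
def adlerSecond (d : NCDerivation F V) (L : PseudoDiffOp V) (p q : ℤ) :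
    PolynomialModule F (V ⊗[F] V) :=
  ∑ᶠ n : ℤ, tensorPoly (L.coeff n)
    (shiftPow d n
      (resolvent d (fun r => Pi.single 0 ((L.adjoint d).evalNegAdd F r)) p) q)

/-- `L(∂)` is of Adler type for the bracket `B`:
`{{L(z)_λ L(w)}} = L(z) ⊗ i_z (z-w-λ-∂)⁻¹ L(w) - L(w+λ+∂) ⊗ i_z (z-w-λ-∂)⁻¹ L*(-z+λ)`,
as an identity between the coefficients of all `z^p w^q`. -/
def IsAdlerType {d : NCDerivation F V} (B : LambdaBracket d) (L : PseudoDiffOp V) : Prop :=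
  ∀ p q : ℤ, B.br (L.coeff p) (L.coeff q) = adlerFirst d L p q - adlerSecond d L p q

/-- The differential subalgebra generated by the coefficients of `L(∂)`: the smallest
unital `∂`-stable subalgebra containing them. -/
def coeffSubalgebra (d : NCDerivation F V) (L : PseudoDiffOp V) : Subalgebra F V :=
  sInf {S : Subalgebra F V | (∀ x ∈ S, d.toLinearMap x ∈ S) ∧ ∀ n, L.coeff n ∈ S}

theorem coeffSubalgebra_stable (d : NCDerivation F V) (L : PseudoDiffOp V) :
    ∀ x ∈ coeffSubalgebra d L, d.toLinearMap x ∈ coeffSubalgebra d L := by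
  intro x hx
  simp only [coeffSubalgebra, Algebra.mem_sInf] at hx ⊢
  exact fun S hS => hS.1 x (hx S hS)

/-- The derivation induced on a `∂`-stable subalgebra. -/
def NCDerivation.restrict (d : NCDerivation F V) (U : Subalgebra F V)
    (hU : ∀ x ∈ U, d.toLinearMap x ∈ U) : NCDerivation F U where
  toFun x := ⟨d.toLinearMap x, hU x x.2⟩
  map_add' x y := Subtype.ext (by simp)
  map_smul' c x := Subtype.ext (by simp)
  leibniz' x y := Subtype.ext (d.leibniz' x y)

/-- The bracket `B'` on the subalgebra `U` is the restriction of the bracket `B` on `V`, i.e.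
`{{a_λ b}}' ∈ (U ⊗ U)[λ]` is sent to `{{a_λ b}}` by the inclusion `(U ⊗ U)[λ] ⊆ (V ⊗ V)[λ]`. -/
def LambdaBracket.IsRestriction {d : NCDerivation F V} (B : LambdaBracket d)
    {U : Subalgebra F V} {d' : NCDerivation F U} (B' : LambdaBracket d') : Prop :=
  ∀ a b : U, PolynomialModule.map F (TensorProduct.map U.val.toLinearMap U.val.toLinearMap)
    (B'.br a b) = B.br (a : V) (b : V)

end Adler

end DoublePVA

end

/-!
Let `t = λ + ∂`, with `∂` acting on the second tensor factor. As `L*(-z+λ) = ∑ (z-λ-∂)ᵐ aₘ`, the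
Adler identity says that `{{L(z)_λ L(w)}}` is the image of `∑ zⁿ wᵐ aₙ ⊗ aₘ` under the divided
difference operator

  `D(t) : f(z, w) ↦ (f(z, w) - f(w+t, z-t)) / (z-w-t)`

(`IsAdlerType.isAdlerFamily`). Its matrix coefficients `adlerKernel` are integer multiples of powers
of `t`. They vanish in high degrees in `z`, `w`, and satisfy `D (z f) = (w+t) D f + f` and
`D (w f) = (z-t) D f - f`. A kernel with the homogeneous versions of these recursions that vanishes
in high degrees and on `f = 1` is zero, because `w+t` and `z-t` act injectively on series bounded
above. In this way one proves two identities: the invariance of `D(t)` under `z ↔ w`, `t ↦ -t`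
(`adlerKernel_neg`), and the associative Yang-Baxter equation
`D₂₃(t) D₁₂(s) = D₁₃(s+t) D₂₃(t) + D₁₂(s) D₁₃(s+t)` in three variables (`adlerJacobi_eq_zero`).
They are skewsymmetry and the Jacobi identity for the coefficients of `L` (`IsAdlerFamily.skew`,
`IsAdlerFamily.jacobi`), where `s = λ + ∂₂` and `t = μ + ∂₃` act on three tensor factors.

Both identities extend to the differential algebra generated by the coefficients. The right side of
the skewsymmetry axiom is an involution that turns one Leibniz rule into the other
(`LambdaBracket.skew_of_generators`). Given skewsymmetry, the Jacobiator is equivariant under cyclic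
permutations of its arguments, of the tensor factors and of the variables `λ`, `μ`, `-λ-μ-∂`
(`LambdaBracket.jacobiator_cyclic`), and it is a derivation in its last argument
(`LambdaBracket.jacobiator_mul`), so that it vanishes if it vanishes on generators
(`LambdaBracket.jacobi_of_generators`).

Finally, the Adler identity shows that the bracket of two coefficients of `L` lies in `(U ⊗ U)[λ]`,
and then the Leibniz rules show this for all elements of `U`. As `F` is a field,
`(U ⊗ U)[λ] → (V ⊗ V)[λ]` is injective. Hence the bracket restricts to a bracket on `U`
(`LambdaBracket.exists_restriction`), to which the above applies.
-/

noncomputable section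

namespace DoublePVA

/-! ### The coefficients of the Adler kernel -/

/-- The binomial coefficient `x choose r` for integers `x` and `r`, which is zero for `r < 0`. -/
def intChoose (x r : ℤ) : ℤ := if 0 ≤ r then Ring.choose x r.toNat else 0

theorem intChoose_of_neg {x r : ℤ} (h : r < 0) : intChoose x r = 0 := by
  simp [intChoose, h]

theorem intChoose_natCast (x : ℤ) (k : ℕ) : intChoose x k = Ring.choose x k := by
  simp [intChoose]

theorem intChoose_succ (x r : ℤ) : intChoose (x + 1) r = intChoose x r + intChoose x (r - 1) := by
  rcases lt_trichotomy r 0 with h | h | h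
  · rw [intChoose_of_neg h, intChoose_of_neg h, intChoose_of_neg (by omega), add_zero]
  · subst h
    simp [intChoose]
  · obtain ⟨k, rfl⟩ : ∃ k : ℕ, r = (k + 1 : ℕ) := ⟨(r - 1).toNat, by omega⟩
    have e : ((k + 1 : ℕ) : ℤ) - 1 = (k : ℕ) := by push_cast; ring
    rw [e, intChoose_natCast, intChoose_natCast, intChoose_natCast, Ring.choose_succ_succ, add_comm]

theorem intChoose_zero_left (r : ℤ) : intChoose 0 r = if r = 0 then 1 else 0 := by
  unfold intChoose
  rcases lt_trichotomy r 0 with h | h | h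
  · rw [if_neg (by omega), if_neg (by omega)]
  · subst h
    simp
  · rw [if_pos h.le, if_neg h.ne', Ring.choose_zero_pos _ (by omega)]

/-- The coefficient of `z^p w^q t^j`, where `j = n + m - 1 - p - q`, in
`i_z (z-w-t)⁻¹ (zⁿ wᵐ - (w+t)ⁿ (z-t)ᵐ)`. -/
def adlerCoeff (n m p q : ℤ) : ℤ :=
  (if p < n then intChoose (n - 1 - p) (n + m - 1 - p - q) else 0) -
    ∑ k ∈ Finset.range (m - p).toNat,
      (Int.negOnePow (m - 1 - p - k) : ℤ) * intChoose m (m - 1 - p - k) *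
        intChoose (n + k) (n + k - q)

theorem adlerCoeff_eq_zero {n m p q : ℤ} (h : n + m ≤ p + q) : adlerCoeff n m p q = 0 := by
  unfold adlerCoeff
  rw [intChoose_of_neg (by omega), ite_self, zero_sub, neg_eq_zero]
  refine Finset.sum_eq_zero fun k _ => ?_
  rcases lt_or_ge (m - 1 - p - k) 0 with h1 | h1
  · simp [intChoose_of_neg h1]
  · simp [intChoose_of_neg (show n + k - q < 0 by omega)]

theorem adlerCoeff_zero_zero (p q : ℤ) : adlerCoeff 0 0 p q = 0 := by
  unfold adlerCoeff
  rcases lt_or_ge p 0 with h | h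
  · obtain ⟨k, rfl⟩ : ∃ k : ℕ, p = -1 - k := ⟨(-1 - p).toNat, by omega⟩
    rw [if_pos h, Finset.sum_eq_single k]
    · simp [intChoose_zero_left]
    · intro b _ hb
      rw [intChoose_zero_left, if_neg (by omega)]
      simp
    · intro hk
      simp only [Finset.mem_range] at hk
      omega
  · rw [if_neg (by omega)]
    rw [show (0 - p).toNat = 0 by omega]
    simp

/-- Multiplication of the argument by the first variable: as `z = (w+t) + (z-w-t)`, the kernel `D`
satisfies `D (z f) = (w+t) D f + f`. -/
theorem adlerCoeff_succ_left (n m p q : ℤ) :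
    adlerCoeff (n + 1) m p q = adlerCoeff n m p (q - 1) + adlerCoeff n m p q +
      if n = p ∧ m = q then 1 else 0 := by
  unfold adlerCoeff
  have h1 : ∀ k : ℕ, intChoose (n + 1 + k) (n + 1 + k - q) =
      intChoose (n + k) (n + k - (q - 1)) + intChoose (n + k) (n + k - q) := by
    intro k
    rw [show n + 1 + (k : ℤ) = n + k + 1 by ring, intChoose_succ]
    congr 2 <;> ring
  simp only [h1, mul_add, Finset.sum_add_distrib]
  rcases lt_trichotomy p n with h | h | h
  · rw [if_pos (by omega), if_pos h, if_pos h, if_neg (by omega),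
      show n + 1 - 1 - p = n - 1 - p + 1 by ring, intChoose_succ]
    rw [show n + 1 + m - 1 - p - q = n + m - 1 - p - (q - 1) by ring,
      show n + m - 1 - p - (q - 1) - 1 = n + m - 1 - p - q by ring]
    ring
  · subst h
    rw [if_pos (by omega), if_neg (by omega), if_neg (by omega), show p + 1 - 1 - p = 0 by ring,
      intChoose_zero_left]
    have : (p + 1 + m - 1 - p - q = 0) ↔ (p = p ∧ m = q) := by omega
    simp only [this]
    ring
  · rw [if_neg (by omega), if_neg (by omega), if_neg (by omega), if_neg (by omega)]
    ring

/-- Multiplication of the argument by the second variable: as `w = (z-t) - (z-w-t)`, the kernel `D`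
satisfies `D (w f) = (z-t) D f - f`. -/
theorem adlerCoeff_succ_right (n m p q : ℤ) :
    adlerCoeff n (m + 1) p q = adlerCoeff n m (p - 1) q - adlerCoeff n m p q -
      if n = p ∧ m = q then 1 else 0 := by
  unfold adlerCoeff
  have h1 : ∀ k : ℕ, (Int.negOnePow (m + 1 - 1 - p - k) : ℤ) *
        intChoose (m + 1) (m + 1 - 1 - p - k) * intChoose (n + k) (n + k - q) =
      (Int.negOnePow (m - 1 - (p - 1) - k) : ℤ) * intChoose m (m - 1 - (p - 1) - k)
        * intChoose (n + k) (n + k - q) -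
      (Int.negOnePow (m - 1 - p - k) : ℤ) * intChoose m (m - 1 - p - k)
        * intChoose (n + k) (n + k - q) := by
    intro k
    rw [intChoose_succ, show m + 1 - 1 - p - (k : ℤ) = (m - 1 - p - k) + 1 by ring,
      show m - 1 - (p - 1) - (k : ℤ) = (m - 1 - p - k) + 1 by ring, Int.negOnePow_succ,
      add_sub_cancel_right]
    push_cast
    ring
  have h2 : ∑ k ∈ Finset.range (m - p).toNat,
      (Int.negOnePow (m - 1 - p - k) : ℤ) * intChoose m (m - 1 - p - k) *
        intChoose (n + k) (n + k - q) = ∑ k ∈ Finset.range (m + 1 - p).toNat,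
      (Int.negOnePow (m - 1 - p - k) : ℤ) * intChoose m (m - 1 - p - k) *
        intChoose (n + k) (n + k - q) := by
    refine Finset.sum_subset (fun k => by simp only [Finset.mem_range]; omega) fun k _ hk => ?_
    simp only [Finset.mem_range] at hk
    rw [intChoose_of_neg (by omega)]
    ring
  rw [h2, show m - (p - 1) = m + 1 - p by ring]
  simp only [h1, Finset.sum_sub_distrib]
  rcases lt_trichotomy p n with h | h | h
  · rw [if_pos h, if_pos (by omega), if_pos h, if_neg (by omega),
      show n - 1 - (p - 1) = n - 1 - p + 1 by ring, intChoose_succ]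
    rw [show n + (m + 1) - 1 - p - q = n + m - 1 - (p - 1) - q by ring,
      show n + m - 1 - (p - 1) - q - 1 = n + m - 1 - p - q by ring]
    ring
  · subst h
    rw [if_neg (by omega), if_pos (by omega), if_neg (by omega), show p - 1 - (p - 1) = 0 by ring,
      intChoose_zero_left]
    have : (p + m - 1 - (p - 1) - q = 0) ↔ (p = p ∧ m = q) := by omega
    simp only [this]
    ring
  · rw [if_neg (by omega), if_neg (by omega), if_neg (by omega), if_neg (by omega)]
    ring

section Kernel

variable {R : Type*} [Ring R]

/-- The matrix coefficients, from `zⁿ wᵐ` to `z^p w^q`, of the divided difference operator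
`f(z, w) ↦ (f(z, w) - f(w+t, z-t)) / (z-w-t)`, expanded in nonnegative powers of `t`. -/
def adlerKernel (t : R) (n m p q : ℤ) : R :=
  adlerCoeff n m p q • t ^ (n + m - 1 - p - q).toNat

theorem adlerKernel_eq_zero (t : R) {n m p q : ℤ} (h : n + m ≤ p + q) :
    adlerKernel t n m p q = 0 := by
  rw [adlerKernel, adlerCoeff_eq_zero h, zero_smul]

theorem adlerKernel_zero_zero (t : R) (p q : ℤ) : adlerKernel t 0 0 p q = 0 := by
  rw [adlerKernel, adlerCoeff_zero_zero, zero_smul]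

theorem mul_adlerKernel (t : R) (n m p q : ℤ) :
    t * adlerKernel t n m p q = adlerCoeff n m p q • t ^ (n + m - p - q).toNat := by
  rcases lt_or_ge (p + q) (n + m) with h | h
  · rw [adlerKernel, mul_smul_comm, ← pow_succ',
      show (n + m - 1 - p - q).toNat + 1 = (n + m - p - q).toNat by omega]
  · rw [adlerKernel_eq_zero t h, adlerCoeff_eq_zero h, mul_zero, zero_smul]

theorem adlerKernel_succ_left (t : R) (n m p q : ℤ) :
    adlerKernel t (n + 1) m p q = adlerKernel t n m p (q - 1) + t * adlerKernel t n m p q +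
      if n = p ∧ m = q then 1 else 0 := by
  rw [mul_adlerKernel, adlerKernel, adlerKernel, adlerCoeff_succ_left, add_smul, add_smul,
    show n + 1 + m - 1 - p - q = n + m - p - q by ring,
    show n + m - 1 - p - (q - 1) = n + m - p - q by ring]
  congr 1
  split_ifs with h
  · rw [h.1, h.2]
    simp
  · simp

theorem adlerKernel_succ_right (t : R) (n m p q : ℤ) :
    adlerKernel t n (m + 1) p q = adlerKernel t n m (p - 1) q - t * adlerKernel t n m p q -
      if n = p ∧ m = q then 1 else 0 := by
  rw [mul_adlerKernel, adlerKernel, adlerKernel, adlerCoeff_succ_right, sub_smul, sub_smul,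
    show n + (m + 1) - 1 - p - q = n + m - p - q by ring,
    show n + m - 1 - (p - 1) - q = n + m - p - q by ring]
  congr 1
  split_ifs with h
  · rw [h.1, h.2]
    simp
  · simp

theorem map_adlerKernel {R' : Type*} [Ring R'] (φ : R →+* R') (t : R) (n m p q : ℤ) :
    φ (adlerKernel t n m p q) = adlerKernel (φ t) n m p q := by
  simp [adlerKernel]

/-- `w + t` acts injectively on sequences that are bounded above. -/
theorem eq_zero_of_shift_add_mul (t : R) (g : ℤ → R) (X : ℤ) (hX : ∀ x, X ≤ x → g x = 0)
    (h : ∀ x, g (x - 1) + t * g x = 0) (x : ℤ) : g x = 0 := by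
  suffices H : ∀ k : ℕ, ∀ x, X ≤ x + k → g x = 0 from H (X - x).toNat x (by omega)
  intro k
  induction k with
  | zero => exact fun x hx => hX x (by simpa using hx)
  | succ k ih =>
    intro x hx
    have := h (x + 1)
    rwa [add_sub_cancel_right, ih (x + 1) (by push_cast at hx; omega), mul_zero, add_zero] at this

/-- A property of the integers that holds at `0` and is invariant under the shift holds
everywhere. -/
theorem int_induction_iff {P : ℤ → Prop} (h0 : P 0) (h : ∀ n, P (n + 1) ↔ P n) (n : ℤ) : P n := by
  induction n using Int.induction_on with
  | zero => exact h0
  | succ k ih => exact (h _).2 ih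
  | pred k ih => exact (h _).1 (by rwa [sub_add_cancel])

/-- The kernel is invariant under exchanging both variables and changing the sign of `t`. The two
sides satisfy the same recursions in `n` and `m`. -/
theorem adlerKernel_neg (t : R) (n m p q : ℤ) :
    adlerKernel (-t) m n q p = -adlerKernel t n m p q := by
  suffices H : ∀ n m, ∀ p q, adlerKernel t n m p q + adlerKernel (-t) m n q p = 0 from
    eq_neg_of_add_eq_zero_right (H n m p q)
  have hc : ∀ n m p q : ℤ, (if m = q ∧ n = p then (1 : R) else 0) =
      if n = p ∧ m = q then 1 else 0 := fun n m p q => by simp only [and_comm]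
  have hl : ∀ n m p q : ℤ, adlerKernel t (n + 1) m p q + adlerKernel (-t) m (n + 1) q p =
      (adlerKernel t n m p (q - 1) + adlerKernel (-t) m n (q - 1) p) +
        t * (adlerKernel t n m p q + adlerKernel (-t) m n q p) := by
    intro n m p q
    rw [adlerKernel_succ_left, adlerKernel_succ_right, hc]
    noncomm_ring
  have hr : ∀ n m p q : ℤ, adlerKernel t n (m + 1) p q + adlerKernel (-t) (m + 1) n q p =
      (adlerKernel t n m (p - 1) q + adlerKernel (-t) m n q (p - 1)) +
        -t * (adlerKernel t n m p q + adlerKernel (-t) m n q p) := by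
    intro n m p q
    rw [adlerKernel_succ_left, adlerKernel_succ_right, hc]
    noncomm_ring
  have hz : ∀ n m p q : ℤ, n + m ≤ p + q →
      adlerKernel t n m p q + adlerKernel (-t) m n q p = 0 := by
    intro n m p q h
    rw [adlerKernel_eq_zero t h, adlerKernel_eq_zero _ (by omega), add_zero]
  refine fun n => int_induction_iff (P := fun m => ∀ p q, adlerKernel t n m p q +
    adlerKernel (-t) m n q p = 0) (fun p q => ?_) fun m => ⟨fun h p q => ?_, fun h p q => ?_⟩
  · revert p q
    refine int_induction_iff (P := fun n => ∀ p q, adlerKernel t n 0 p q +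
      adlerKernel (-t) 0 n q p = 0) (fun p q => ?_) (fun n => ⟨fun h p q => ?_, fun h p q => ?_⟩) n
    · rw [adlerKernel_zero_zero, adlerKernel_zero_zero, add_zero]
    · refine eq_zero_of_shift_add_mul t (fun q => _) (n + 0 - p)
        (fun q hq => hz n 0 p q (by omega)) (fun q => ?_) q
      rw [← hl, h]
    · rw [hl, h, h, mul_zero, add_zero]
  · refine eq_zero_of_shift_add_mul (-t) (fun p => _) (n + m - q)
      (fun p hp => hz n m p q (by omega)) (fun p => ?_) p
    rw [← hr, h]
  · rw [hr, h, h, mul_zero, add_zero]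

end Kernel

section Jacobi

variable {R : Type*} [CommRing R]

theorem finite_support_of_bounds {f : ℤ → R} {a b : ℤ} (ha : ∀ x, x < a → f x = 0)
    (hb : ∀ x, b < x → f x = 0) : f.support.Finite :=
  (Set.finite_Icc a b).subset fun x hx => by
    by_contra h
    rw [Set.mem_Icc, not_and_or, not_le, not_le] at h
    exact hx (h.elim (ha x) (hb x))

/-- The scalar form of the Jacobi identity: the divided difference operators `D₁₂(s)`, `D₂₃(t)`,
`D₁₃(s+t)` in three variables satisfy the associative Yang-Baxter equation
`D₂₃ D₁₂ - D₁₃ D₂₃ - D₁₂ D₁₃ = 0`. Its left side is given here by its matrix coefficients, from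
`zⁿ wᵐ vˡ` to `z^p w^q v^r`. -/
def adlerJacobi (s t : R) (n m l p q r : ℤ) : R :=
  ∑ᶠ x, adlerKernel s n m p x * adlerKernel t x l q r -
    ∑ᶠ x, adlerKernel (s + t) n x p r * adlerKernel t m l q x -
    ∑ᶠ x, adlerKernel s x m p q * adlerKernel (s + t) n l x r

variable (s t : R)

theorem finite_support_one (n m l p q r : ℤ) :
    (Function.support fun x => adlerKernel s n m p x * adlerKernel t x l q r).Finite :=
  finite_support_of_bounds (a := q + r - l) (b := n + m - p)
    (fun x hx => by rw [adlerKernel_eq_zero t (by omega), mul_zero])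
    (fun x hx => by rw [adlerKernel_eq_zero s (by omega), zero_mul])

theorem finite_support_two (n m l p q r : ℤ) :
    (Function.support fun x => adlerKernel s n x p r * adlerKernel t m l q x).Finite :=
  finite_support_of_bounds (a := p + r - n) (b := m + l - q)
    (fun x hx => by rw [adlerKernel_eq_zero s (by omega), zero_mul])
    (fun x hx => by rw [adlerKernel_eq_zero t (by omega), mul_zero])

theorem finite_support_three (n m l p q r : ℤ) :
    (Function.support fun x => adlerKernel s x m p q * adlerKernel t n l x r).Finite :=
  finite_support_of_bounds (a := p + q - m) (b := n + l - r)
    (fun x hx => by rw [adlerKernel_eq_zero s (by omega), zero_mul])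
    (fun x hx => by rw [adlerKernel_eq_zero t (by omega), mul_zero])

theorem adlerJacobi_eq_zero_of_le {n m l p q r : ℤ} (h : n + m + l ≤ p + q + r + 1) :
    adlerJacobi s t n m l p q r = 0 := by
  have h1 : ∀ x, adlerKernel s n m p x * adlerKernel t x l q r = 0 := fun x => by
    rcases le_or_gt (n + m) (p + x) with hx | hx
    · rw [adlerKernel_eq_zero s hx, zero_mul]
    · rw [adlerKernel_eq_zero t (by omega), mul_zero]
  have h2 : ∀ x, adlerKernel (s + t) n x p r * adlerKernel t m l q x = 0 := fun x => by
    rcases le_or_gt (n + x) (p + r) with hx | hx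
    · rw [adlerKernel_eq_zero _ hx, zero_mul]
    · rw [adlerKernel_eq_zero t (by omega), mul_zero]
  have h3 : ∀ x, adlerKernel s x m p q * adlerKernel (s + t) n l x r = 0 := fun x => by
    rcases le_or_gt (x + m) (p + q) with hx | hx
    · rw [adlerKernel_eq_zero s hx, zero_mul]
    · rw [adlerKernel_eq_zero (s + t) (by omega), mul_zero]
  simp [adlerJacobi, h1, h2, h3]

theorem adlerJacobi_zero (p q r : ℤ) : adlerJacobi s t 0 0 0 p q r = 0 := by
  simp only [adlerJacobi, adlerKernel_zero_zero, zero_mul, mul_zero]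
  simp

theorem finsum_add_mul_add {f g h : ℤ → R} (c : R) (hf : f.support.Finite)
    (hg : g.support.Finite) (hh : h.support.Finite) :
    ∑ᶠ x, (f x + c * g x + h x) = ∑ᶠ x, f x + c * ∑ᶠ x, g x + ∑ᶠ x, h x := by
  have hg' : (Function.support fun x => c * g x).Finite :=
    hg.subset fun x hx h0 => hx (by simp only [h0, mul_zero])
  rw [finsum_add_distrib ((hf.union hg').subset (Function.support_add f _)) hh,
    finsum_add_distrib hf hg',
    mul_finsum' g c hg]

theorem finsum_shift (f g : ℤ → R) : ∑ᶠ x, f (x - 1) * g x = ∑ᶠ x, f x * g (x + 1) := by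
  rw [← finsum_comp_equiv (Equiv.addRight (1 : ℤ))]
  simp

theorem finsum_ite_mul (g : ℤ → R) (P : Prop) [Decidable P] (a : ℤ) :
    ∑ᶠ x, (if P ∧ a = x then 1 else 0) * g x = if P then g a else 0 := by
  rw [finsum_eq_single _ a (fun x hx => by rw [if_neg (fun h => hx h.2.symm), zero_mul])]
  simp

theorem finite_support_ite_mul (g : ℤ → R) (P : Prop) [Decidable P] (a : ℤ) :
    (Function.support fun x => (if P ∧ a = x then 1 else 0) * g x).Finite :=
  (Set.finite_singleton a).subset fun x hx => by
    by_contra h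
    exact hx (by simp only [if_neg fun h' : P ∧ a = x => h h'.2.symm, zero_mul])

/-- A recursion for the matrix coefficients of one factor, summed against the other factor. -/
theorem finsum_kernel_comp {u v f g : ℤ → R} {P : Prop} [Decidable P] {a : ℤ} (c : R)
    (h : ∀ x, u x = f x + c * g x + if P ∧ a = x then 1 else 0)
    (hf : (Function.support fun x => f x * v x).Finite)
    (hg : (Function.support fun x => g x * v x).Finite) :
    ∑ᶠ x, u x * v x = ∑ᶠ x, f x * v x + c * ∑ᶠ x, g x * v x + if P then v a else 0 := by
  simp only [h, add_mul, mul_assoc]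
  rw [finsum_add_mul_add c hf hg (finite_support_ite_mul v P a), finsum_ite_mul]

theorem finsum_kernel_comp' {u v f g : ℤ → R} {P : Prop} [Decidable P] {a : ℤ} (c : R)
    (h : ∀ x, u x = f x + c * g x + if P ∧ a = x then 1 else 0)
    (hf : (Function.support fun x => v x * f x).Finite)
    (hg : (Function.support fun x => v x * g x).Finite) :
    ∑ᶠ x, v x * u x = ∑ᶠ x, v x * f x + c * ∑ᶠ x, v x * g x + if P then v a else 0 := by
  simp only [mul_comm (v _)] at hf hg ⊢
  exact finsum_kernel_comp c h hf hg

theorem finsum_kernel_comp_sub {u v f g : ℤ → R} {P : Prop} [Decidable P] {a : ℤ} (c : R)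
    (h : ∀ x, u x = f x - c * g x - if P ∧ a = x then 1 else 0)
    (hf : (Function.support fun x => f x * v x).Finite)
    (hg : (Function.support fun x => g x * v x).Finite) :
    ∑ᶠ x, u x * v x = ∑ᶠ x, f x * v x - c * ∑ᶠ x, g x * v x - if P then v a else 0 := by
  have := finsum_kernel_comp (u := fun x => -u x) (f := fun x => -f x) c
    (fun x => by rw [h]; ring)
    (by simpa only [neg_mul, Function.support_fun_neg] using hf) hg
  simp only [neg_mul, finsum_neg_distrib] at this
  linear_combination -this

theorem finsum_kernel_comp_sub' {u v f g : ℤ → R} {P : Prop} [Decidable P] {a : ℤ} (c : R)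
    (h : ∀ x, u x = f x - c * g x - if P ∧ a = x then 1 else 0)
    (hf : (Function.support fun x => v x * f x).Finite)
    (hg : (Function.support fun x => v x * g x).Finite) :
    ∑ᶠ x, v x * u x = ∑ᶠ x, v x * f x - c * ∑ᶠ x, v x * g x - if P then v a else 0 := by
  simp only [mul_comm (v _)] at hf hg ⊢
  exact finsum_kernel_comp_sub c h hf hg

/-- If `J` is the left side of the Yang-Baxter equation, then `J (z f) = (v+s+t) J f`: the
inhomogeneous terms of the recursions for the three summands cancel. -/
theorem adlerJacobi_succ_one (n m l p q r : ℤ) :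
    adlerJacobi s t (n + 1) m l p q r =
      adlerJacobi s t n m l p q (r - 1) + (s + t) * adlerJacobi s t n m l p q r := by
  have h1 : ∑ᶠ x, adlerKernel s (n + 1) m p x * adlerKernel t x l q r =
      (∑ᶠ x, adlerKernel s n m p x * adlerKernel t x l q (r - 1) +
        t * ∑ᶠ x, adlerKernel s n m p x * adlerKernel t x l q r +
        if l = r then adlerKernel s n m p q else 0) +
      s * ∑ᶠ x, adlerKernel s n m p x * adlerKernel t x l q r +
      if n = p then adlerKernel t m l q r else 0 := by
    rw [finsum_kernel_comp s (fun x => adlerKernel_succ_left s n m p x)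
      (finite_support_of_bounds (a := q + r - l) (b := n + m - p + 1)
        (fun x hx => by rw [adlerKernel_eq_zero t (by omega), mul_zero])
        (fun x hx => by rw [adlerKernel_eq_zero s (by omega), zero_mul]))
      (finite_support_one s t n m l p q r), finsum_shift,
      finsum_kernel_comp' t (P := l = r) (a := q)
        (fun x => by rw [adlerKernel_succ_left t x l q r]; simp only [and_comm, eq_comm])
      (finite_support_one s t n m l p q (r - 1)) (finite_support_one s t n m l p q r)]
  have h2 : ∑ᶠ x, adlerKernel (s + t) (n + 1) x p r * adlerKernel t m l q x =
      ∑ᶠ x, adlerKernel (s + t) n x p (r - 1) * adlerKernel t m l q x +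
      (s + t) * ∑ᶠ x, adlerKernel (s + t) n x p r * adlerKernel t m l q x +
      if n = p then adlerKernel t m l q r else 0 :=
    finsum_kernel_comp (s + t)
      (fun x => by rw [adlerKernel_succ_left (s + t) n x p r]; simp only [eq_comm])
      (finite_support_two (s + t) t n m l p q (r - 1)) (finite_support_two (s + t) t n m l p q r)
  have h3 : ∑ᶠ x, adlerKernel s x m p q * adlerKernel (s + t) (n + 1) l x r =
      ∑ᶠ x, adlerKernel s x m p q * adlerKernel (s + t) n l x (r - 1) +
      (s + t) * ∑ᶠ x, adlerKernel s x m p q * adlerKernel (s + t) n l x r +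
      if l = r then adlerKernel s n m p q else 0 :=
    finsum_kernel_comp' (s + t)
      (fun x => by rw [adlerKernel_succ_left (s + t) n l x r]; simp only [and_comm])
      (finite_support_three s (s + t) n m l p q (r - 1))
      (finite_support_three s (s + t) n m l p q r)
  rw [adlerJacobi, h1, h2, h3, adlerJacobi, adlerJacobi]
  ring

/-- In the notation of `adlerJacobi_succ_one`, `J (w f) = (z-s) J f`. -/
theorem adlerJacobi_succ_two (n m l p q r : ℤ) :
    adlerJacobi s t n (m + 1) l p q r =
      adlerJacobi s t n m l (p - 1) q r + -s * adlerJacobi s t n m l p q r := by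
  have h1 : ∑ᶠ x, adlerKernel s n (m + 1) p x * adlerKernel t x l q r =
      ∑ᶠ x, adlerKernel s n m (p - 1) x * adlerKernel t x l q r -
      s * ∑ᶠ x, adlerKernel s n m p x * adlerKernel t x l q r -
      if n = p then adlerKernel t m l q r else 0 :=
    finsum_kernel_comp_sub s (fun x => adlerKernel_succ_right s n m p x)
      (finite_support_one s t n m l (p - 1) q r) (finite_support_one s t n m l p q r)
  have h2 : ∑ᶠ x, adlerKernel (s + t) n x p r * adlerKernel t (m + 1) l q x =
      (∑ᶠ x, adlerKernel (s + t) n x (p - 1) r * adlerKernel t m l q x -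
      (s + t) * ∑ᶠ x, adlerKernel (s + t) n x p r * adlerKernel t m l q x -
      if n = p then adlerKernel t m l q r else 0) +
      t * ∑ᶠ x, adlerKernel (s + t) n x p r * adlerKernel t m l q x +
      if m = q then adlerKernel (s + t) n l p r else 0 := by
    rw [finsum_kernel_comp' t (P := m = q) (a := l)
        (fun x => by rw [adlerKernel_succ_left t m l q x])
        (finite_support_of_bounds (a := p + r - n) (b := m + l - q + 1)
          (fun x hx => by rw [adlerKernel_eq_zero (s + t) (by omega), zero_mul])
          (fun x hx => by rw [adlerKernel_eq_zero t (by omega), mul_zero]))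
        (finite_support_two (s + t) t n m l p q r)]
    simp only [mul_comm (adlerKernel (s + t) _ _ _ _)]
    rw [finsum_shift (adlerKernel t m l q)]
    simp only [mul_comm (adlerKernel t _ _ _ _)]
    rw [finsum_kernel_comp_sub (s + t) (P := n = p) (a := r)
        (fun x => by rw [adlerKernel_succ_right (s + t) n x p r]; simp only [eq_comm])
        (finite_support_two (s + t) t n m l (p - 1) q r)
        (finite_support_two (s + t) t n m l p q r)]
  have h3 : ∑ᶠ x, adlerKernel s x (m + 1) p q * adlerKernel (s + t) n l x r =
      ∑ᶠ x, adlerKernel s x m (p - 1) q * adlerKernel (s + t) n l x r -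
      s * ∑ᶠ x, adlerKernel s x m p q * adlerKernel (s + t) n l x r -
      if m = q then adlerKernel (s + t) n l p r else 0 :=
    finsum_kernel_comp_sub s
      (fun x => by rw [adlerKernel_succ_right s x m p q]; simp only [and_comm, eq_comm])
      (finite_support_three s (s + t) n m l (p - 1) q r)
      (finite_support_three s (s + t) n m l p q r)
  rw [adlerJacobi, h1, h2, h3, adlerJacobi, adlerJacobi]
  ring

/-- In the notation of `adlerJacobi_succ_one`, `J (v f) = (w-t) J f`. -/
theorem adlerJacobi_succ_three (n m l p q r : ℤ) :
    adlerJacobi s t n m (l + 1) p q r =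
      adlerJacobi s t n m l p (q - 1) r + -t * adlerJacobi s t n m l p q r := by
  have h1 : ∑ᶠ x, adlerKernel s n m p x * adlerKernel t x (l + 1) q r =
      ∑ᶠ x, adlerKernel s n m p x * adlerKernel t x l (q - 1) r -
      t * ∑ᶠ x, adlerKernel s n m p x * adlerKernel t x l q r -
      if l = r then adlerKernel s n m p q else 0 :=
    finsum_kernel_comp_sub' t
      (fun x => by rw [adlerKernel_succ_right t x l q r]; simp only [and_comm, eq_comm])
      (finite_support_one s t n m l p (q - 1) r) (finite_support_one s t n m l p q r)
  have h2 : ∑ᶠ x, adlerKernel (s + t) n x p r * adlerKernel t m (l + 1) q x =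
      ∑ᶠ x, adlerKernel (s + t) n x p r * adlerKernel t m l (q - 1) x -
      t * ∑ᶠ x, adlerKernel (s + t) n x p r * adlerKernel t m l q x -
      if m = q then adlerKernel (s + t) n l p r else 0 :=
    finsum_kernel_comp_sub' t (fun x => adlerKernel_succ_right t m l q x)
      (finite_support_two (s + t) t n m l p (q - 1) r) (finite_support_two (s + t) t n m l p q r)
  have h3 : ∑ᶠ x, adlerKernel s x m p q * adlerKernel (s + t) n (l + 1) x r =
      (∑ᶠ x, adlerKernel s x m p (q - 1) * adlerKernel (s + t) n l x r +
      s * ∑ᶠ x, adlerKernel s x m p q * adlerKernel (s + t) n l x r +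
      if m = q then adlerKernel (s + t) n l p r else 0) -
      (s + t) * ∑ᶠ x, adlerKernel s x m p q * adlerKernel (s + t) n l x r -
      if l = r then adlerKernel s n m p q else 0 := by
    rw [finsum_kernel_comp_sub' (s + t) (P := l = r) (a := n)
        (f := fun x => adlerKernel (s + t) n l (x - 1) r)
        (g := fun x => adlerKernel (s + t) n l x r)
        (fun x => by rw [adlerKernel_succ_right (s + t) n l x r]; simp only [and_comm])
        (finite_support_of_bounds (a := p + q - m) (b := n + l - r + 1)
          (fun x hx => by rw [adlerKernel_eq_zero s (by omega), zero_mul])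
          (fun x hx => by rw [adlerKernel_eq_zero (s + t) (by omega), mul_zero]))
        (finite_support_three s (s + t) n m l p q r)]
    simp only [mul_comm (adlerKernel s _ _ _ _)]
    rw [finsum_shift fun x => adlerKernel (s + t) n l x r]
    simp only [mul_comm (adlerKernel (s + t) _ _ _ _)]
    rw [finsum_kernel_comp s (P := m = q) (a := p)
        (fun x => by rw [adlerKernel_succ_left s x m p q]; simp only [and_comm, eq_comm])
        (finite_support_three s (s + t) n m l p (q - 1) r)
        (finite_support_three s (s + t) n m l p q r)]
  rw [adlerJacobi, h1, h2, h3, adlerJacobi, adlerJacobi]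
  ring

/-- The Yang-Baxter equation. The operators `z`, `w`, `v` are invertible, and `v+s+t`, `z-s`, `w-t`
act injectively on series bounded above, so that the recursions reduce the claim to `J 1 = 0`. -/
theorem adlerJacobi_eq_zero (n m l p q r : ℤ) : adlerJacobi s t n m l p q r = 0 := by
  suffices H : ∀ n m l, ∀ p q r, adlerJacobi s t n m l p q r = 0 from H n m l p q r
  have hz := @adlerJacobi_eq_zero_of_le R _ s t
  refine fun n m => int_induction_iff (P := fun l => ∀ p q r, adlerJacobi s t n m l p q r = 0)
    ?_ fun l => ⟨fun h p q r => ?_, fun h p q r => ?_⟩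
  · revert m
    refine int_induction_iff (P := fun m => ∀ p q r, adlerJacobi s t n m 0 p q r = 0)
      ?_ fun m => ⟨fun h p q r => ?_, fun h p q r => ?_⟩
    · revert n
      refine int_induction_iff (P := fun n => ∀ p q r, adlerJacobi s t n 0 0 p q r = 0)
        ?_ fun n => ⟨fun h p q r => ?_, fun h p q r => ?_⟩
      · exact adlerJacobi_zero s t
      · refine eq_zero_of_shift_add_mul (s + t) (fun r => adlerJacobi s t n 0 0 p q r) (n - p - q)
          (fun r hr => hz (by omega)) (fun r => ?_) r
        rw [← adlerJacobi_succ_one, h]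
      · rw [adlerJacobi_succ_one, h, h, mul_zero, add_zero]
    · refine eq_zero_of_shift_add_mul (-s) (fun p => adlerJacobi s t n m 0 p q r) (n + m - q - r)
        (fun p hp => hz (by omega)) (fun p => ?_) p
      rw [← adlerJacobi_succ_two, h]
    · rw [adlerJacobi_succ_two, h, h, mul_zero, add_zero]
  · refine eq_zero_of_shift_add_mul (-t) (fun q => adlerJacobi s t n m l p q r) (n + m + l - p - r)
      (fun q hq => hz (by omega)) (fun q => ?_) q
    rw [← adlerJacobi_succ_three, h]
  · rw [adlerJacobi_succ_three, h, h, mul_zero, add_zero]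

end Jacobi

/-! ### Polynomials with coefficients in a vector space -/

section PolyLemmas

variable {F : Type*} [Field F]
variable {M : Type*} [AddCommGroup M] [Module F M]
variable {N : Type*} [AddCommGroup N] [Module F N]
variable {P : Type*} [AddCommGroup P] [Module F P]
variable {Q : Type*} [AddCommGroup Q] [Module F Q]

theorem lsingle_eq_single (k : ℕ) (x : M) :
    PolynomialModule.lsingle F k x = PolynomialModule.single F k x := rfl

theorem mulVar_single (k : ℕ) (x : M) :
    mulVar F M (PolynomialModule.single F k x) = PolynomialModule.single F (k + 1) x := by
  simp only [mulVar, Algebra.lsmul_coe, ← Polynomial.monomial_one_one_eq_X,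
    PolynomialModule.monomial_smul_single, one_smul, add_comm 1]

theorem polyMap_map (f : M →ₗ[F] N) (g : N →ₗ[F] P) (p : PolynomialModule F M) :
    PolynomialModule.map F g (PolynomialModule.map F f p) =
      PolynomialModule.map F (g ∘ₗ f) p := by
  induction p using PolynomialModule.induction_linear with
  | zero => simp only [map_zero]
  | add p q hp hq => simp only [map_add, hp, hq]
  | single k x => simp

theorem polyMap_id (p : PolynomialModule F M) :
    PolynomialModule.map F (LinearMap.id : M →ₗ[F] M) p = p := by
  induction p using PolynomialModule.induction_linear with
  | zero => simp only [map_zero]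
  | add p q hp hq => simp only [map_add, hp, hq]
  | single k x => simp

theorem polyMap_zero : PolynomialModule.map F (0 : M →ₗ[F] N) = 0 :=
  map_zero (mapHom : (M →ₗ[F] N) →ₗ[F] _)

theorem polyMap_comm {f : M →ₗ[F] N} {g : N →ₗ[F] Q} {f' : M →ₗ[F] P} {g' : P →ₗ[F] Q}
    (h : ∀ x, g (f x) = g' (f' x)) (p : PolynomialModule F M) :
    PolynomialModule.map F g (PolynomialModule.map F f p) =
      PolynomialModule.map F g' (PolynomialModule.map F f' p) := by
  rw [polyMap_map, polyMap_map, show g ∘ₗ f = g' ∘ₗ f' from LinearMap.ext h]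

theorem polyMap_injective {f : M →ₗ[F] N} (hf : Function.Injective f) :
    Function.Injective (PolynomialModule.map F f) := by
  intro p q h
  refine PolynomialModule.ext (Finsupp.mapRange_injective f (map_zero f) hf ?_)
  exact congrArg PolynomialModule.coeff h

theorem map_mulVar (f : M →ₗ[F] N) (p : PolynomialModule F M) :
    PolynomialModule.map F f (mulVar F M p) = mulVar F N (PolynomialModule.map F f p) := by
  induction p using PolynomialModule.induction_linear with
  | zero => simp only [map_zero]
  | add p q hp hq => simp only [map_add, hp, hq]
  | single k x => simp only [mulVar_single, PolynomialModule.map_single]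

theorem varAdd_apply (D : Module.End F M) (p : PolynomialModule F M) :
    varAdd D p = mulVar F M p + PolynomialModule.map F D p := rfl

theorem map_varAdd {f : M →ₗ[F] N} {D : Module.End F M} {D' : Module.End F N}
    (h : ∀ x, f (D x) = D' (f x)) (p : PolynomialModule F M) :
    PolynomialModule.map F f (varAdd D p) = varAdd D' (PolynomialModule.map F f p) := by
  rw [varAdd_apply, varAdd_apply, map_add, map_mulVar, polyMap_comm h]

theorem varAdd_comm_map {D D' : Module.End F M} (h : ∀ x, D (D' x) = D' (D x))
    (p : PolynomialModule F M) :
    PolynomialModule.map F D (varAdd D' p) = varAdd D' (PolynomialModule.map F D p) :=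
  map_varAdd h p

theorem apply_pow_of_comm {f : M →ₗ[F] N} {T : Module.End F M} {T' : Module.End F N}
    (h : ∀ x, f (T x) = T' (f x)) (k : ℕ) (x : M) : f ((T ^ k) x) = (T' ^ k) (f x) := by
  induction k generalizing x with
  | zero => rfl
  | succ k ih => rw [pow_succ, pow_succ, Module.End.mul_apply, Module.End.mul_apply, ih, h]

theorem apply_adlerKernel_of_comm {f : M →ₗ[F] N} {T : Module.End F M} {T' : Module.End F N}
    (h : ∀ x, f (T x) = T' (f x)) (n m p q : ℤ) (x : M) :
    f (adlerKernel T n m p q x) = adlerKernel T' n m p q (f x) := by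
  simp only [adlerKernel, LinearMap.smul_apply, map_zsmul, apply_pow_of_comm h]

theorem subst_single (T : Module.End F N) (ι : M →ₗ[F] N) (k : ℕ) (x : M) :
    subst T ι (PolynomialModule.single F k x) = (T ^ k) (ι x) := by
  simp [subst]

theorem subst_single_zero (T : Module.End F N) (ι : M →ₗ[F] N) (x : M) :
    subst T ι (PolynomialModule.single F 0 x) = ι x := by
  rw [subst_single, pow_zero, Module.End.one_apply]

theorem subst_mulVar (T : Module.End F N) (ι : M →ₗ[F] N) (p : PolynomialModule F M) :
    subst T ι (mulVar F M p) = T (subst T ι p) := by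
  induction p using PolynomialModule.induction_linear with
  | zero => simp only [map_zero]
  | add p q hp hq => simp only [map_add, hp, hq]
  | single k x => rw [mulVar_single, subst_single, subst_single, pow_succ', Module.End.mul_apply]

theorem subst_map (T : Module.End F N) (ι : P →ₗ[F] N) (f : M →ₗ[F] P)
    (p : PolynomialModule F M) :
    subst T ι (PolynomialModule.map F f p) = subst T (ι ∘ₗ f) p := by
  induction p using PolynomialModule.induction_linear with
  | zero => simp only [map_zero]
  | add p q hp hq => simp only [map_add, hp, hq]
  | single k x => simp only [PolynomialModule.map_single, subst_single, LinearMap.comp_apply]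

theorem apply_subst {T : Module.End F N} {ι : M →ₗ[F] N} {g : N →ₗ[F] P} {T' : Module.End F P}
    (h : ∀ x, g (T x) = T' (g x)) (p : PolynomialModule F M) :
    g (subst T ι p) = subst T' (g ∘ₗ ι) p := by
  induction p using PolynomialModule.induction_linear with
  | zero => simp only [map_zero]
  | add p q hp hq => simp only [map_add, hp, hq]
  | single k x => simp only [subst_single, LinearMap.comp_apply, apply_pow_of_comm h]

theorem subst_comp_add (T : Module.End F N) (ι κ : M →ₗ[F] N) (p : PolynomialModule F M) :
    subst T (ι + κ) p = subst T ι p + subst T κ p := by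
  induction p using PolynomialModule.induction_linear with
  | zero => simp only [map_zero, add_zero]
  | add p q hp hq => simp only [map_add, hp, hq]; abel
  | single k x => simp only [subst_single, LinearMap.add_apply, map_add]

theorem subst_zero_comp (T : Module.End F N) (p : PolynomialModule F M) :
    subst T (0 : M →ₗ[F] N) p = 0 := by
  induction p using PolynomialModule.induction_linear with
  | zero => rw [map_zero]
  | add p q hp hq => rw [map_add, hp, hq, add_zero]
  | single k x => rw [subst_single, LinearMap.zero_apply, map_zero]

theorem subst_neg_comp (T : Module.End F N) (ι : M →ₗ[F] N) (p : PolynomialModule F M) :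
    subst T (-ι) p = -subst T ι p := by
  rw [eq_neg_iff_add_eq_zero, ← subst_comp_add, neg_add_cancel, subst_zero_comp]

theorem subst_map_comm {T : Module.End F N} {ι : M →ₗ[F] N} {D : Module.End F M}
    {D' : Module.End F N} (h : ∀ x, ι (D x) = D' (ι x)) (hT : ∀ y, D' (T y) = T (D' y))
    (p : PolynomialModule F M) :
    subst T ι (PolynomialModule.map F D p) = D' (subst T ι p) := by
  rw [subst_map, apply_subst hT, show ι ∘ₗ D = D' ∘ₗ ι from LinearMap.ext h]

theorem subst_varAdd {T : Module.End F N} {ι : M →ₗ[F] N} {D : Module.End F M}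
    {D' : Module.End F N} (h : ∀ x, ι (D x) = D' (ι x)) (hT : ∀ y, D' (T y) = T (D' y))
    (p : PolynomialModule F M) :
    subst T ι (varAdd D p) = (T + D') (subst T ι p) := by
  rw [varAdd_apply, map_add, subst_mulVar, subst_map_comm h hT, LinearMap.add_apply]

variable {D : Module.End F M} {β : P →ₗ[F] M →ₗ[F] N}

theorem arrow_single (k : ℕ) (h : P) (b : M) :
    arrow D β (PolynomialModule.single F k h) b =
      PolynomialModule.map F (β h) ((varAdd D ^ k) (PolynomialModule.single F 0 b)) := by
  rw [arrow_apply, PolynomialModule.coeff_single, Finsupp.sum_single_index]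
  rw [map_zero, polyMap_zero, LinearMap.zero_apply]

/-- If `D'` acts on `β x y` by the Leibniz rule, through `E` on `x` and `D` on `y`, then applying
`λ + E` to the polynomial amounts to applying `λ + D'` to the result. -/
theorem arrow_varAdd {E : Module.End F P} {D' : Module.End F N}
    (h : ∀ x y, D' (β x y) = β (E x) y + β x (D y)) (p : PolynomialModule F P) (b : M) :
    arrow D β (varAdd E p) b = varAdd D' (arrow D β p b) := by
  induction p using PolynomialModule.induction_linear with
  | zero => simp only [map_zero, LinearMap.zero_apply]
  | add p q hp hq => simp only [map_add, LinearMap.add_apply, hp, hq]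
  | single k x =>
    have h' : ∀ u, PolynomialModule.map F D' (PolynomialModule.map F (β x) u) =
        PolynomialModule.map F (β (E x)) u +
          PolynomialModule.map F (β x) (PolynomialModule.map F D u) := by
      intro u
      rw [polyMap_map, polyMap_map, ← LinearMap.add_apply, ← map_add_map]
      congr 2
      exact LinearMap.ext (h x)
    rw [varAdd_apply, map_add, LinearMap.add_apply, mulVar_single, PolynomialModule.map_single,
      arrow_single, arrow_single, arrow_single, pow_succ', Module.End.mul_apply, varAdd_apply,
      varAdd_apply, map_add, map_mulVar, h']
    abel

theorem arrow_apply_comm {D' : Module.End F N} (h : ∀ x y, D' (β x y) = β x (D y))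
    (p : PolynomialModule F P) (b : M) :
    arrow D β p (D b) = PolynomialModule.map F D' (arrow D β p b) := by
  induction p using PolynomialModule.induction_linear with
  | zero => simp only [map_zero, LinearMap.zero_apply]
  | add p q hp hq => simp only [map_add, LinearMap.add_apply, hp, hq]
  | single k x =>
    rw [arrow_single, arrow_single, ← PolynomialModule.map_single, polyMap_map,
      show D' ∘ₗ β x = β x ∘ₗ D from LinearMap.ext (h x), ← polyMap_map,
      apply_pow_of_comm (varAdd_comm_map fun _ => rfl)]

theorem map_arrow_of_comm {P' M' N' : Type*} [AddCommGroup P'] [Module F P'] [AddCommGroup M']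
    [Module F M'] [AddCommGroup N'] [Module F N'] {β' : P' →ₗ[F] M' →ₗ[F] N'}
    {f : P →ₗ[F] P'} {g : N →ₗ[F] N'} {e : M →ₗ[F] M'} {E : Module.End F M'}
    (h : ∀ x y, g (β x y) = β' (f x) (e y)) (he : ∀ y, e (D y) = E (e y))
    (p : PolynomialModule F P) (b : M) :
    PolynomialModule.map F g (arrow D β p b) =
      arrow E β' (PolynomialModule.map F f p) (e b) := by
  induction p using PolynomialModule.induction_linear with
  | zero => simp only [map_zero, LinearMap.zero_apply]
  | add p q hp hq => simp only [map_add, LinearMap.add_apply, hp, hq]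
  | single k x =>
    rw [PolynomialModule.map_single, arrow_single, arrow_single, ← PolynomialModule.map_single,
      ← apply_pow_of_comm (map_varAdd he)]
    exact polyMap_comm (h x) _

theorem map_arrow {P' N' : Type*} [AddCommGroup P'] [Module F P'] [AddCommGroup N'] [Module F N']
    {β' : P' →ₗ[F] M →ₗ[F] N'} {f : P →ₗ[F] P'} {g : N →ₗ[F] N'}
    (h : ∀ x y, g (β x y) = β' (f x) y) (p : PolynomialModule F P) (b : M) :
    PolynomialModule.map F g (arrow D β p b) = arrow D β' (PolynomialModule.map F f p) b :=
  map_arrow_of_comm (D := D) (E := D) (e := LinearMap.id) h (fun _ => rfl) p b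

/-- The substitution of `-λ-E` for `λ`, moved to the left, so that `E` acts on the coefficients. -/
def skewSubst (E : Module.End F M) : Module.End F (PolynomialModule F M) :=
  subst (-varAdd E) (PolynomialModule.lsingle F 0)

theorem skewSubst_single_zero (E : Module.End F M) (x : M) :
    skewSubst E (PolynomialModule.single F 0 x) = PolynomialModule.single F 0 x :=
  subst_single_zero _ _ _

theorem skewSubst_mulVar (E : Module.End F M) (p : PolynomialModule F M) :
    skewSubst E (mulVar F M p) = -varAdd E (skewSubst E p) :=
  subst_mulVar _ _ _

theorem skewSubst_map {E : Module.End F M} {E' : Module.End F N} {f : M →ₗ[F] N}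
    (h : ∀ x, f (E x) = E' (f x)) (p : PolynomialModule F M) :
    skewSubst E' (PolynomialModule.map F f p) = PolynomialModule.map F f (skewSubst E p) := by
  rw [skewSubst, skewSubst, apply_subst (T' := -varAdd E') (fun x => by
    rw [LinearMap.neg_apply, map_neg, map_varAdd h, LinearMap.neg_apply]), subst_map]
  congr 2
  ext x
  simp [lsingle_eq_single]

theorem skewSubst_varAdd {E G : Module.End F M} (h : ∀ x, G (E x) = E (G x))
    (p : PolynomialModule F M) :
    skewSubst E (varAdd G p) = (-varAdd (E - G)) (skewSubst E p) := by
  have : PolynomialModule.map F (E - G) = PolynomialModule.map F E - PolynomialModule.map F G :=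
    map_sub (mapHom : (M →ₗ[F] M) →ₗ[F] _) E G
  rw [varAdd_apply, map_add, skewSubst_mulVar, skewSubst_map h, LinearMap.neg_apply, varAdd_apply,
    varAdd_apply, this, LinearMap.sub_apply]
  abel

theorem skewSubst_skewSubst (E : Module.End F M) (p : PolynomialModule F M) :
    skewSubst E (skewSubst E p) = p := by
  induction p using PolynomialModule.induction_linear with
  | zero => simp only [map_zero]
  | add p q hp hq => simp only [map_add, hp, hq]
  | single k x =>
    induction k with
    | zero => rw [skewSubst_single_zero, skewSubst_single_zero]
    | succ k ih =>
      have : PolynomialModule.map F (E - E) = 0 := by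
        rw [sub_self]
        exact polyMap_zero
      rw [← mulVar_single, skewSubst_mulVar, map_neg, skewSubst_varAdd fun _ => rfl,
        LinearMap.neg_apply, neg_neg, ih, varAdd_apply, this, LinearMap.zero_apply, add_zero]

/-- If `D'` acts on `β x y` by the Leibniz rule, then after the substitution of `-λ-∂` for `λ` the
derivatives of the second argument cancel. -/
theorem skewSubst_arrow {E : Module.End F P} {D' : Module.End F N}
    (h : ∀ x y, D' (β x y) = β (E x) y + β x (D y)) (p : PolynomialModule F P) (b : M) :
    skewSubst D' (arrow D β p b) = PolynomialModule.map F (β.flip b) (skewSubst E p) := by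
  induction p using PolynomialModule.induction_linear with
  | zero => simp only [map_zero, LinearMap.zero_apply]
  | add p q hp hq => simp only [map_add, LinearMap.add_apply, hp, hq]
  | single k x =>
    induction k generalizing x with
    | zero =>
      rw [arrow_single, pow_zero, Module.End.one_apply, PolynomialModule.map_single,
        skewSubst_single_zero, skewSubst_single_zero, PolynomialModule.map_single]
      rfl
    | succ k ih =>
      have h1 := arrow_varAdd h (PolynomialModule.single F k x) b
      rw [varAdd_apply, mulVar_single, PolynomialModule.map_single, map_add,
        LinearMap.add_apply, ← eq_sub_iff_add_eq] at h1
      have h2 : ∀ y, skewSubst D' (varAdd D' y) = -mulVar F N (skewSubst D' y) := by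
        intro y
        rw [skewSubst_varAdd fun _ => rfl, LinearMap.neg_apply, varAdd_apply, sub_self,
          polyMap_zero, LinearMap.zero_apply, add_zero]
      rw [h1, map_sub, h2, ih, ih, ← mulVar_single, skewSubst_mulVar, varAdd_apply, map_neg,
        map_add, map_mulVar, ← skewSubst_map (fun _ => rfl : ∀ x, E (E x) = E (E x)),
        PolynomialModule.map_single]
      abel

end PolyLemmas

/-! ### The Adler identity in terms of the kernel -/

theorem finsum_nat_add {W : Type*} [AddCommMonoid W] (G : ℤ → W) (b : ℤ) (t : Finset ℤ)
    (hb : ∀ m < b, G m = 0) (ht : ∀ m ∉ t, G m = 0) :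
    ∑ᶠ j : ℕ, G (b + j) = ∑ m ∈ t, G m := by
  have hinj : Function.Injective fun j : ℕ => b + (j : ℤ) := fun i j h => by simpa using h
  rw [← finsum_mem_range hinj (f := G), finsum_mem_def, Set.indicator_eq_self.2,
    finsum_eq_sum_of_support_subset]
  · intro m hm
    by_contra h
    exact hm (ht m h)
  · intro m hm
    refine ⟨(m - b).toNat, ?_⟩
    have : b ≤ m := by
      by_contra h
      exact hm (hb m (not_le.1 h))
    simp only
    omega

/-- The Vandermonde identity, the sum being taken over all `j` with `0 ≤ j`. -/
theorem sum_choose_mul_intChoose (x y r : ℤ) (K : ℕ) (hK : r < K) :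
    ∑ j ∈ Finset.range K, Ring.choose x j * intChoose y (r - j) = intChoose (x + y) r := by
  rcases lt_or_ge r 0 with h | h
  · rw [intChoose_of_neg h]
    exact Finset.sum_eq_zero fun j _ => by rw [intChoose_of_neg (by omega), mul_zero]
  · obtain ⟨k, rfl⟩ := Int.eq_ofNat_of_zero_le h
    rw [intChoose_natCast, Ring.add_choose_eq k (Commute.all x y),
      Finset.Nat.sum_antidiagonal_eq_sum_range_succ_mk]
    symm
    refine Finset.sum_subset_zero_on_sdiff
      (fun j => by simp only [Finset.mem_range]; omega) (fun j hj => ?_) fun j hj => ?_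
    · simp only [Finset.mem_sdiff, Finset.mem_range] at hj
      rw [intChoose_of_neg (by omega), mul_zero]
    · simp only [Finset.mem_range] at hj
      rw [show (k : ℤ) - j = (k - j : ℕ) by omega, intChoose_natCast]

section

variable {F V : Type*} [Field F] [Ring V] [Algebra F V] (d : NCDerivation F V)

/-- The derivation of the second tensor factor. -/
def NCDerivation.snd : Module.End F (V ⊗[F] V) := TensorProduct.map LinearMap.id d.toLinearMap

theorem tensorPoly_single (a y : V) (k : ℕ) :
    tensorPoly (F := F) a (PolynomialModule.single F k y) =
      PolynomialModule.single F k (a ⊗ₜ[F] y) := by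
  simp [tensorPoly]

theorem tensorPoly_varAdd_pow (a : V) (p : PolynomialModule F V) (k : ℕ) :
    tensorPoly a ((varAdd d.toLinearMap ^ k) p) = (varAdd d.snd ^ k) (tensorPoly a p) :=
  apply_pow_of_comm (map_varAdd fun x => by simp [NCDerivation.snd]) k p

theorem shiftPow_zero (n q : ℤ) : shiftPow d n (0 : ℤ → PolynomialModule F V) q = 0 := by
  simp [shiftPow]

theorem resolvent_single (g : ℤ → PolynomialModule F V) (p q : ℤ) :
    resolvent d (Pi.single 0 g) p q = if p < 0 then shiftPow d (-1 - p) g q else 0 := by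
  unfold resolvent
  split_ifs with h
  · rw [finsum_eq_single _ (-1 - p).toNat]
    · rw [show p + ((-1 - p).toNat : ℤ) + 1 = 0 by omega, Pi.single_eq_same,
        show ((-1 - p).toNat : ℤ) = -1 - p by omega]
    · intro k hk
      rw [Pi.single_eq_of_ne (by omega)]
      exact shiftPow_zero d _ _
  · refine finsum_eq_zero_of_forall_eq_zero fun k => ?_
    rw [Pi.single_eq_of_ne (by omega)]
    exact shiftPow_zero d _ _

theorem shiftPow_single (n q : ℤ) (e : PolynomialModule F V) :
    shiftPow d n (Pi.single 0 e) q =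
      intChoose n (n - q) • (varAdd d.toLinearMap ^ (n - q).toNat) e := by
  unfold shiftPow
  rcases lt_or_ge (n - q) 0 with h | h
  · rw [intChoose_of_neg h, zero_smul]
    refine finsum_eq_zero_of_forall_eq_zero fun j => ?_
    rw [Pi.single_eq_of_ne (by omega), map_zero, smul_zero]
  · rw [finsum_eq_single _ (n - q).toNat]
    · rw [show q - n + ((n - q).toNat : ℤ) = 0 by omega, Pi.single_eq_same, intChoose, if_pos h]
    · intro j hj
      rw [Pi.single_eq_of_ne (by omega), map_zero, smul_zero]

theorem varAdd_pow_single_zero {M : Type*} [AddCommGroup M] [Module F M] (D : Module.End F M)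
    (h : ℕ) (x : M) :
    (varAdd D ^ h) (PolynomialModule.single F 0 x) = ∑ i ∈ Finset.range (h + 1),
      (h.choose i : ℤ) • PolynomialModule.single F i ((D ^ (h - i)) x) := by
  have hc : Commute (mulVar F M) (PolynomialModule.map F D : Module.End F _) :=
    LinearMap.ext fun p => by
      rw [Module.End.mul_apply, Module.End.mul_apply, map_mulVar]
  have h1 : ∀ (i : ℕ) (k : ℕ) (y : M), (mulVar F M ^ i) (PolynomialModule.single F k y) =
      PolynomialModule.single F (k + i) y := by
    intro i
    induction i with
    | zero => intro k y; rfl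
    | succ i ih =>
      intro k y
      rw [pow_succ', Module.End.mul_apply, ih, mulVar_single, add_assoc]
  have h2 : ∀ (i : ℕ) (y : M), ((PolynomialModule.map F D : Module.End F _) ^ i)
      (PolynomialModule.single F 0 y) = PolynomialModule.single F 0 ((D ^ i) y) := by
    intro i y
    exact (apply_pow_of_comm (f := PolynomialModule.lsingle F 0)
      (fun x => (PolynomialModule.map_single F D 0 x).symm) i y).symm
  rw [varAdd, hc.add_pow, LinearMap.sum_apply]
  refine Finset.sum_congr rfl fun i _ => ?_
  rw [← Nat.cast_comm, Module.End.mul_apply, Module.End.mul_apply, h2, h1, zero_add]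
  simp [Module.End.natCast_apply]

variable (L : PseudoDiffOp V)

/-- The symbol of the adjoint: `L*(-z+λ) = ∑ₙ (z-λ-∂)ⁿ aₙ`. -/
theorem evalNegAdd_adjoint (r : ℤ) : (L.adjoint d).evalNegAdd F r =
    ∑ᶠ h : ℕ, (Int.negOnePow h : ℤ) • Ring.choose (r + h : ℤ) h •
      (varAdd d.toLinearMap ^ h) (PolynomialModule.single F 0 (L.coeff (r + h))) := by
  obtain ⟨N, hN⟩ := L.bdd
  obtain ⟨K, hK⟩ : ∃ K : ℕ, N < r + K := ⟨(N - r + 1).toNat, by omega⟩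
  have ha : ∀ h : ℕ, K ≤ h → L.coeff (r + h) = 0 := fun h hh => hN _ (by omega)
  have hadj : ∀ i : ℕ, (L.adjoint d).coeff (r + i) = ∑ j ∈ Finset.range (K - i),
      (Int.negOnePow (r + i + j) : ℤ) • Ring.choose (r + i + j : ℤ) j •
        (d.toLinearMap ^ j) (L.coeff (r + (i + j : ℕ))) := by
    intro i
    rw [PseudoDiffOp.adjoint]
    simp only
    rw [finsum_eq_sum_of_support_subset (s := Finset.range (K - i))]
    · simp only [Nat.cast_add, add_assoc]
    · intro j hj
      by_contra h
      simp only [Finset.coe_range, Set.mem_Iio, not_lt] at h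
      refine hj ?_
      simp only
      rw [add_assoc, ← Nat.cast_add, ha _ (by omega), map_zero, smul_zero, smul_zero]
  rw [PseudoDiffOp.evalNegAdd, finsum_eq_sum_of_support_subset (s := Finset.range K),
    finsum_eq_sum_of_support_subset (s := Finset.range K)]
  rotate_left
  · intro j hj
    by_contra h
    simp only [Finset.coe_range, Set.mem_Iio, not_lt] at h
    refine hj ?_
    simp only
    rw [ha j h, PolynomialModule.single_zero, map_zero, smul_zero, smul_zero]
  · intro i hi
    by_contra h
    simp only [Finset.coe_range, Set.mem_Iio, not_lt] at h
    refine hi ?_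
    simp only
    rw [hadj, Nat.sub_eq_zero_of_le h, Finset.sum_range_zero, PolynomialModule.single_zero,
      smul_zero, smul_zero]
  have hsign : ∀ i j : ℕ, (Int.negOnePow r : ℤ) * (Int.negOnePow (r + i + j) : ℤ) =
      (Int.negOnePow (i + j : ℕ) : ℤ) := by
    intro i j
    rw [← Units.val_mul, ← Int.negOnePow_add, show r + (r + i + j) = r + r + (i + j) by ring,
      Int.negOnePow_add, Int.negOnePow_even _ (Even.add_self r), one_mul, Nat.cast_add]
  have hch : ∀ i j : ℕ, Ring.choose (r + i : ℤ) i * Ring.choose (r + i + j : ℤ) j =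
      Ring.choose (r + (i + j : ℕ) : ℤ) (i + j) * ((i + j).choose i : ℤ) := by
    intro i j
    have := Ring.choose_smul_choose (r + (i + j : ℕ) : ℤ) (n := i + j) (k := j) (by omega)
    rw [nsmul_eq_mul, Nat.add_sub_cancel] at this
    rw [show (i + j).choose i = (i + j).choose j from Nat.choose_symm_add, mul_comm _ (Nat.cast _),
      this, mul_comm, Nat.cast_add, show r + ((i : ℤ) + j) - j = r + i by ring, add_assoc]
  -- Both sides are sums over `i + j < K`, with `i` and `j` the exponents of `λ` and `∂`.
  symm
  simp only [varAdd_pow_single_zero, Finset.smul_sum]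
  refine Eq.trans (Finset.sum_congr rfl fun h _ => Finset.sum_congr rfl fun i hi => ?_)
    ((Finset.sum_range_diag_flip K fun i j => (Int.negOnePow (i + j : ℕ) : ℤ) •
      Ring.choose (r + (i + j : ℕ) : ℤ) (i + j) • ((i + j).choose i : ℤ) •
        PolynomialModule.single F i ((d.toLinearMap ^ j) (L.coeff (r + (i + j : ℕ))))).trans
      (Finset.sum_congr rfl fun i _ => ?_))
  · simp only [Finset.mem_range] at hi
    rw [Nat.add_sub_cancel' (by omega)]
  · rw [hadj, ← lsingle_eq_single, map_sum, Finset.smul_sum, Finset.smul_sum]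
    refine Finset.sum_congr rfl fun j _ => ?_
    rw [map_zsmul, map_zsmul, lsingle_eq_single]
    simp only [smul_smul]
    rw [← hsign, mul_assoc, ← hch]
    congr 1
    ring

variable {L}

theorem tensorPoly_zero (p : PolynomialModule F V) : tensorPoly (0 : V) p = 0 := by
  rw [tensorPoly, map_zero, polyMap_zero, LinearMap.zero_apply]

theorem shiftPow_eq_sum (n q : ℤ) (g : ℤ → PolynomialModule F V) (t : Finset ℤ)
    (ht : ∀ m ∉ t, q - n ≤ m → g m = 0) :
    shiftPow d n g q = ∑ m ∈ t,
      intChoose n (m - (q - n)) • (varAdd d.toLinearMap ^ (m - (q - n)).toNat) (g m) := by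
  rw [shiftPow, ← finsum_nat_add _ (q - n) t
    (fun m hm => by rw [intChoose_of_neg (by omega), zero_smul]) fun m hm => ?_]
  · refine finsum_congr fun j => ?_
    rw [show q - n + (j : ℤ) - (q - n) = j by ring, intChoose_natCast, Int.toNat_natCast]
  · rcases lt_or_ge m (q - n) with h | h
    · rw [intChoose_of_neg (by omega), zero_smul]
    · rw [ht m hm h, map_zero, smul_zero]

theorem adlerFirst_eq {N : ℤ} (hN : ∀ n, N < n → L.coeff n = 0) (p q : ℤ) {s t : Finset ℤ}
    (hs : Finset.Icc (p + q + 1 - N) N ⊆ s) (ht : Finset.Icc (p + q + 1 - N) N ⊆ t) :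
    adlerFirst d L p q = ∑ n ∈ s, ∑ m ∈ t,
      (if p < n then intChoose (n - 1 - p) (n + m - 1 - p - q) else 0) •
        (varAdd d.snd ^ (n + m - 1 - p - q).toNat)
          (PolynomialModule.single F 0 (L.coeff n ⊗ₜ[F] L.coeff m)) := by
  have hG : ∀ n, tensorPoly (L.coeff n)
      (resolvent d (Pi.single 0 fun m => PolynomialModule.single F 0 (L.coeff m)) (p - n) q) =
      ∑ m ∈ t, (if p < n then intChoose (n - 1 - p) (n + m - 1 - p - q) else 0) •
        (varAdd d.snd ^ (n + m - 1 - p - q).toNat)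
          (PolynomialModule.single F 0 (L.coeff n ⊗ₜ[F] L.coeff m)) := by
    intro n
    rcases lt_or_ge N n with hn | hn
    · simp [hN n hn, tensorPoly_zero]
    rw [resolvent_single]
    rcases le_or_gt n p with h | h
    · rw [if_neg (by omega), map_zero]
      exact (Finset.sum_eq_zero fun m _ => by rw [if_neg (by omega), zero_smul]).symm
    · rw [if_pos (by omega), shiftPow_eq_sum d _ _ _ t, map_sum]
      · refine Finset.sum_congr rfl fun m _ => ?_
        rw [map_zsmul, tensorPoly_varAdd_pow, tensorPoly_single, if_pos h,
          show m - (q - (-1 - (p - n))) = n + m - 1 - p - q by ring,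
          show -1 - (p - n) = n - 1 - p by ring]
      · intro m hm hqm
        rw [hN, PolynomialModule.single_zero]
        by_contra hc
        exact hm (ht (Finset.mem_Icc.2 ⟨by omega, by omega⟩))
  rw [adlerFirst, finsum_eq_sum_of_support_subset (s := s)]
  · exact Finset.sum_congr rfl fun n _ => hG n
  · intro n hn
    by_contra hs'
    refine hn ?_
    simp only
    rw [hG]
    refine Finset.sum_eq_zero fun m _ => ?_
    rcases lt_or_ge N n with h1 | h1
    · simp [hN n h1]
    rcases lt_or_ge N m with h2 | h2
    · simp [hN m h2]
    have : n < p + q + 1 - N := by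
      by_contra hc
      exact hs' (hs (Finset.mem_Icc.2 ⟨by omega, h1⟩))
    rw [intChoose_of_neg (by omega), ite_self, zero_smul]

theorem intChoose_smul_pow_mul {R : Type*} [Ring R] (T : R) (x y r r' : ℤ) :
    (intChoose x r • T ^ r.toNat) * (intChoose y r' • T ^ r'.toNat) =
      (intChoose x r * intChoose y r') • T ^ (r + r').toNat := by
  rcases lt_or_ge r 0 with h | h
  · rw [intChoose_of_neg h, zero_smul, zero_mul, zero_mul, zero_smul]
  rcases lt_or_ge r' 0 with h' | h'
  · rw [intChoose_of_neg h', zero_smul, mul_zero, mul_zero, zero_smul]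
  rw [smul_mul_smul_comm, ← pow_add, Int.toNat_add h h']

/-- The two powers of `w+λ+∂` in the second term of the Adler identity combine into one. -/
theorem shiftPow_resolvent (n p q : ℤ) (e : ℤ → PolynomialModule F V) (K : ℕ)
    (hK : ∀ k, p + K < k → e k = 0) :
    shiftPow d n (resolvent d (fun r => Pi.single 0 (e r)) p) q =
      ∑ k ∈ Finset.range K, intChoose (n + k) (n + k - q) •
        (varAdd d.toLinearMap ^ (n + k - q).toNat) (e (p + k + 1)) := by
  have h1 : ∀ q', resolvent d (fun r => Pi.single 0 (e r)) p q' = ∑ k ∈ Finset.range K,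
      intChoose k (k - q') • (varAdd d.toLinearMap ^ (k - q' : ℤ).toNat) (e (p + k + 1)) := by
    intro q'
    rw [resolvent, finsum_eq_sum_of_support_subset (s := Finset.range K)]
    · exact Finset.sum_congr rfl fun k _ => shiftPow_single d _ _ _
    · intro k hk
      by_contra h
      simp only [Finset.coe_range, Set.mem_Iio, not_lt] at h
      refine hk ?_
      simp only
      rw [hK _ (by omega), Pi.single_zero]
      exact shiftPow_zero d _ _
  set T := varAdd d.toLinearMap with hT
  have h2 : ∀ j k : ℕ, Ring.choose n j • (T ^ j) (intChoose k (k - (q - n + j)) •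
      (T ^ (k - (q - n + j) : ℤ).toNat) (e (p + k + 1))) =
      (Ring.choose n j * intChoose k (n + k - q - j)) •
        (T ^ (n + k - q).toNat) (e (p + k + 1)) := by
    intro j k
    have := intChoose_smul_pow_mul T n k j (n + k - q - j)
    rw [intChoose_natCast, add_sub_cancel, Int.toNat_natCast] at this
    rw [show (k : ℤ) - (q - n + j) = n + k - q - j by ring]
    simpa only [Module.End.mul_apply, LinearMap.smul_apply] using
      LinearMap.congr_fun this (e (p + k + 1))
  simp only [shiftPow, h1, map_sum, Finset.smul_sum]
  rw [← hT]
  simp only [h2]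
  have h3 : ∀ k j : ℕ, (n + k - q).toNat + 1 ≤ j → intChoose k (n + k - q - j) = 0 :=
    fun k j h => intChoose_of_neg (by omega)
  have hsub : ∀ k : ℕ, (Function.support fun j : ℕ => (Ring.choose n j *
      intChoose k (n + k - q - j)) • (T ^ (n + k - q).toNat) (e (p + k + 1))) ⊆
      Finset.range ((n + k - q).toNat + 1) := by
    intro k j hj
    by_contra h
    simp only [Finset.coe_range, Set.mem_Iio, not_lt] at h
    exact hj (by simp only; rw [h3 k j h, mul_zero, zero_smul])
  rw [finsum_sum_comm _ _ fun k _ => (Finset.finite_toSet _).subset (hsub k)]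
  refine Finset.sum_congr rfl fun k _ => ?_
  rw [finsum_eq_sum_of_support_subset _ (hsub k), ← Finset.sum_smul,
    sum_choose_mul_intChoose _ _ _ _ (by omega)]

theorem evalNegAdd_adjoint_eq_sum (r : ℤ) (t : Finset ℤ)
    (ht : ∀ m ∉ t, r ≤ m → L.coeff m = 0) : (L.adjoint d).evalNegAdd F r =
    ∑ m ∈ t, ((Int.negOnePow (m - r) : ℤ) * intChoose m (m - r)) •
      (varAdd d.toLinearMap ^ (m - r).toNat) (PolynomialModule.single F 0 (L.coeff m)) := by
  rw [evalNegAdd_adjoint, ← finsum_nat_add _ r t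
    (fun m hm => by rw [intChoose_of_neg (by omega), mul_zero, zero_smul]) fun m hm => ?_]
  · refine finsum_congr fun j => ?_
    rw [show r + (j : ℤ) - r = j by ring, intChoose_natCast, Int.toNat_natCast, smul_smul]
  · rcases lt_or_ge m r with h | h
    · rw [intChoose_of_neg (by omega), mul_zero, zero_smul]
    · rw [ht m hm h, PolynomialModule.single_zero, map_zero, smul_zero]

theorem adlerSecond_eq {N : ℤ} (hN : ∀ n, N < n → L.coeff n = 0) (p q : ℤ) {s t : Finset ℤ}
    (hs : Finset.Icc (p + q + 1 - N) N ⊆ s) (ht : Finset.Icc (p + 1) N ⊆ t) :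
    adlerSecond d L p q = ∑ n ∈ s, ∑ m ∈ t,
      (∑ k ∈ Finset.range (m - p).toNat,
        (Int.negOnePow (m - 1 - p - k) : ℤ) * intChoose m (m - 1 - p - k) *
          intChoose (n + k) (n + k - q)) •
        (varAdd d.snd ^ (n + m - 1 - p - q).toNat)
          (PolynomialModule.single F 0 (L.coeff n ⊗ₜ[F] L.coeff m)) := by
  have hE : ∀ k, p + (N - p).toNat < k → (L.adjoint d).evalNegAdd F k = 0 := by
    intro k hk
    rw [evalNegAdd_adjoint_eq_sum d k ∅ fun m _ hm => hN m (by omega), Finset.sum_empty]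
  set T := varAdd d.snd with hT
  have hS : ∀ n, tensorPoly (L.coeff n) (shiftPow d n
      (resolvent d (fun r => Pi.single 0 ((L.adjoint d).evalNegAdd F r)) p) q) =
      ∑ k ∈ Finset.range (N - p).toNat, intChoose (n + k) (n + k - q) • (T ^ (n + k - q).toNat)
        (∑ m ∈ t, ((Int.negOnePow (m - 1 - p - k) : ℤ) * intChoose m (m - 1 - p - k)) •
          (T ^ (m - 1 - p - k).toNat)
            (PolynomialModule.single F 0 (L.coeff n ⊗ₜ[F] L.coeff m))) := by
    intro n
    rw [shiftPow_resolvent d n p q _ _ hE, map_sum]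
    refine Finset.sum_congr rfl fun k hk => ?_
    rw [evalNegAdd_adjoint_eq_sum d _ t, map_zsmul, tensorPoly_varAdd_pow, map_sum]
    · congr 2
      refine Finset.sum_congr rfl fun m _ => ?_
      rw [map_zsmul, tensorPoly_varAdd_pow, tensorPoly_single,
        show m - (p + (k : ℤ) + 1) = m - 1 - p - k by ring]
    · intro m hm hkm
      refine hN m ?_
      by_contra hc
      exact hm (ht (Finset.mem_Icc.2 ⟨by omega, by omega⟩))
  have hG : ∀ n, tensorPoly (L.coeff n) (shiftPow d n
      (resolvent d (fun r => Pi.single 0 ((L.adjoint d).evalNegAdd F r)) p) q) =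
      ∑ m ∈ t, (∑ k ∈ Finset.range (m - p).toNat,
        (Int.negOnePow (m - 1 - p - k) : ℤ) * intChoose m (m - 1 - p - k) *
          intChoose (n + k) (n + k - q)) • (T ^ (n + m - 1 - p - q).toNat)
          (PolynomialModule.single F 0 (L.coeff n ⊗ₜ[F] L.coeff m)) := by
    intro n
    simp only [hS, map_sum, Finset.smul_sum]
    rw [Finset.sum_comm]
    refine Finset.sum_congr rfl fun m _ => ?_
    rcases lt_or_ge N m with h1 | h1
    · simp [hN m h1]
    have hk : ∀ k : ℕ, intChoose (n + k) (n + k - q) • (T ^ (n + k - q).toNat)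
        (((Int.negOnePow (m - 1 - p - k) : ℤ) * intChoose m (m - 1 - p - k)) •
          (T ^ (m - 1 - p - k).toNat)
            (PolynomialModule.single F 0 (L.coeff n ⊗ₜ[F] L.coeff m))) =
        ((Int.negOnePow (m - 1 - p - k) : ℤ) * intChoose m (m - 1 - p - k) *
          intChoose (n + k) (n + k - q)) • (T ^ (n + m - 1 - p - q).toNat)
          (PolynomialModule.single F 0 (L.coeff n ⊗ₜ[F] L.coeff m)) := by
      intro k
      have := intChoose_smul_pow_mul T (n + k) m (n + k - q) (m - 1 - p - k)
      have := LinearMap.congr_fun this (PolynomialModule.single F 0 (L.coeff n ⊗ₜ[F] L.coeff m))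
      simp only [Module.End.mul_apply, LinearMap.smul_apply] at this
      rw [mul_smul, map_zsmul, smul_comm, this, smul_smul,
        show n + (k : ℤ) - q + (m - 1 - p - k) = n + m - 1 - p - q by ring]
      congr 1
      ring
    simp only [hk]
    rw [← Finset.sum_smul]
    congr 1
    symm
    refine Finset.sum_subset (fun k => by simp only [Finset.mem_range]; omega) fun k _ hk => ?_
    simp only [Finset.mem_range] at hk
    rw [intChoose_of_neg (show m - 1 - p - (k : ℤ) < 0 by omega), mul_zero, zero_mul]
  rw [adlerSecond, finsum_eq_sum_of_support_subset (s := s)]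
  · exact Finset.sum_congr rfl fun n _ => hG n
  · intro n hn
    by_contra hs'
    refine hn ?_
    simp only
    rcases lt_or_ge N n with h1 | h1
    · rw [hN n h1, tensorPoly_zero]
    have : n < p + q + 1 - N := by
      by_contra hc
      exact hs' (hs (Finset.mem_Icc.2 ⟨by omega, h1⟩))
    rw [hS]
    refine Finset.sum_eq_zero fun k hk => ?_
    simp only [Finset.mem_range] at hk
    rw [intChoose_of_neg (show n + (k : ℤ) - q < 0 by omega), zero_smul]

end

section

variable {F V : Type*} [Field F] [Ring V] [Algebra F V] {d : NCDerivation F V}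

/-- The Adler identity for a sequence `a` that vanishes above `N`: the bracket of `a p` and `a q`
is the coefficient of `z^p w^q` in the divided difference of `∑ (a n ⊗ a m) zⁿ wᵐ`, taken with
`t = λ + ∂` acting on the second tensor factor. The sum is finite, and its range may be
enlarged. -/
structure IsAdlerFamily (B : LambdaBracket d) (a : ℤ → V) (N : ℤ) : Prop where
  eq_zero : ∀ n, N < n → a n = 0
  br_eq : ∀ p q, ∀ s t : Finset ℤ, Finset.Icc (p + q + 1 - N) N ⊆ s →
    Finset.Icc (p + q + 1 - N) N ⊆ t → B.br (a p) (a q) =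
      ∑ n ∈ s, ∑ m ∈ t, adlerKernel (varAdd d.snd) n m p q
        (PolynomialModule.single F 0 (a n ⊗ₜ[F] a m))

/-- The two terms of the Adler identity combine into the divided difference: in the second one,
`L*(-z+λ) = ∑ (z-λ-∂)ᵐ aₘ`. -/
theorem IsAdlerType.isAdlerFamily {B : LambdaBracket d} {L : PseudoDiffOp V}
    (hL : IsAdlerType B L) {N : ℤ} (hN : ∀ n, N < n → L.coeff n = 0) :
    IsAdlerFamily B L.coeff N := by
  refine ⟨hN, fun p q s t hs ht => ?_⟩
  have hzero : ∀ n m, n ∉ s ∨ m ∉ t → adlerKernel (varAdd d.snd) n m p q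
      (PolynomialModule.single F 0 (L.coeff n ⊗ₜ[F] L.coeff m)) = 0 := by
    intro n m h
    rcases lt_or_ge N n with hn | hn
    · simp [hN n hn]
    rcases lt_or_ge N m with hm | hm
    · simp [hN m hm]
    rw [adlerKernel_eq_zero, LinearMap.zero_apply]
    by_contra hc
    rcases h with h | h
    · exact h (hs (Finset.mem_Icc.2 ⟨by omega, hn⟩))
    · exact h (ht (Finset.mem_Icc.2 ⟨by omega, hm⟩))
  have h2 : ∀ n, ∑ m ∈ t, adlerKernel (varAdd d.snd) n m p q
      (PolynomialModule.single F 0 (L.coeff n ⊗ₜ[F] L.coeff m)) =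
      ∑ m ∈ t ∪ Finset.Icc (p + 1) N, adlerKernel (varAdd d.snd) n m p q
      (PolynomialModule.single F 0 (L.coeff n ⊗ₜ[F] L.coeff m)) := fun n =>
    Finset.sum_subset Finset.subset_union_left fun m _ hm => hzero n m (Or.inr hm)
  rw [hL p q, adlerFirst_eq d hN p q hs (t := t ∪ Finset.Icc (p + 1) N)
      (ht.trans Finset.subset_union_left),
    adlerSecond_eq d hN p q hs (t := t ∪ Finset.Icc (p + 1) N) Finset.subset_union_right]
  simp only [h2, ← Finset.sum_sub_distrib, ← sub_smul]
  rfl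

end

/-! ### Polynomials in two variables -/

section TwoVariables

variable {F : Type*} [Field F]
variable {M : Type*} [AddCommGroup M] [Module F M]
variable {N : Type*} [AddCommGroup N] [Module F N]
variable {P : Type*} [AddCommGroup P] [Module F P]

/-- A linear map applied to the coefficients of a polynomial in two variables. -/
def mapTwo (f : M →ₗ[F] N) : PolynomialModule F (PolynomialModule F M) →ₗ[F]
    PolynomialModule F (PolynomialModule F N) :=
  PolynomialModule.map F (PolynomialModule.map F f)

/-- The constant polynomial in two variables. -/
def constTwo (x : M) : PolynomialModule F (PolynomialModule F M) :=
  PolynomialModule.single F 0 (PolynomialModule.single F 0 x)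

theorem mapTwo_mulMu (f : M →ₗ[F] N) (p : PolynomialModule F (PolynomialModule F M)) :
    mapTwo f (mulMu F M p) = mulMu F N (mapTwo f p) := map_mulVar _ p

theorem mapTwo_mulLam (f : M →ₗ[F] N) (p : PolynomialModule F (PolynomialModule F M)) :
    mapTwo f (mulLam F M p) = mulLam F N (mapTwo f p) := polyMap_comm (map_mulVar f) p

theorem mulLam_mulMu (p : PolynomialModule F (PolynomialModule F M)) :
    mulLam F M (mulMu F M p) = mulMu F M (mulLam F M p) := map_mulVar _ p

theorem mapTwo_comm {f : M →ₗ[F] N} {Q : Type*} [AddCommGroup Q] [Module F Q] {g : N →ₗ[F] Q}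
    {f' : M →ₗ[F] P} {g' : P →ₗ[F] Q} (h : ∀ x, g (f x) = g' (f' x))
    (p : PolynomialModule F (PolynomialModule F M)) :
    mapTwo g (mapTwo f p) = mapTwo g' (mapTwo f' p) := polyMap_comm (polyMap_comm h) p

theorem mapTwo_add (f g : M →ₗ[F] N) : mapTwo (f + g) = mapTwo f + mapTwo g := by
  rw [mapTwo, map_add_map, map_add_map]
  rfl

/-- The operator `λ + D` on `M[λ, μ]`, with `D` acting on the coefficients. -/
def lamAdd (D : Module.End F M) : Module.End F (PolynomialModule F (PolynomialModule F M)) :=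
  mulLam F M + mapTwo D

/-- The operator `μ + D` on `M[λ, μ]`, with `D` acting on the coefficients. -/
def muAdd (D : Module.End F M) : Module.End F (PolynomialModule F (PolynomialModule F M)) :=
  mulMu F M + mapTwo D

theorem muAdd_mulLam (D : Module.End F M) (p : PolynomialModule F (PolynomialModule F M)) :
    muAdd D (mulLam F M p) = mulLam F M (muAdd D p) := by
  rw [muAdd, LinearMap.add_apply, LinearMap.add_apply, map_add, mulLam_mulMu, mapTwo_mulLam]

theorem inclMu_mulVar (p : PolynomialModule F M) :
    inclMu F M (mulVar F M p) = mulMu F M (inclMu F M p) := map_mulVar _ p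

theorem inclMu_map (f : M →ₗ[F] N) (p : PolynomialModule F M) :
    inclMu F N (PolynomialModule.map F f p) = mapTwo f (inclMu F M p) :=
  polyMap_comm (fun x => (PolynomialModule.map_single F f 0 x).symm) p

theorem inclMu_varAdd (D : Module.End F M) (p : PolynomialModule F M) :
    inclMu F M (varAdd D p) = muAdd D (inclMu F M p) := by
  rw [varAdd_apply, map_add, inclMu_mulVar, inclMu_map]
  rfl

theorem inclMu_single (x : M) : inclMu F M (PolynomialModule.single F 0 x) = constTwo x := by
  simp [inclMu, constTwo, lsingle_eq_single]

theorem evalLamAddMu_mulVar (p : PolynomialModule F M) :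
    evalLamAddMu F M (mulVar F M p) = (mulLam F M + mulMu F M) (evalLamAddMu F M p) :=
  subst_mulVar _ _ p

theorem evalLamAddMu_single (x : M) :
    evalLamAddMu F M (PolynomialModule.single F 0 x) = constTwo x := subst_single_zero _ _ x

theorem evalLamAddMu_map (f : M →ₗ[F] N) (p : PolynomialModule F M) :
    evalLamAddMu F N (PolynomialModule.map F f p) = mapTwo f (evalLamAddMu F M p) := by
  rw [evalLamAddMu, evalLamAddMu, subst_map,
    apply_subst (g := mapTwo f) (T' := mulLam F N + mulMu F N)
      (fun x => by rw [LinearMap.add_apply, map_add, mapTwo_mulLam, mapTwo_mulMu]; rfl)]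
  congr 2
  ext x
  simp [mapTwo, lsingle_eq_single]

/-- Linear maps on `M[λ, μ]` are equal if they agree on constants and intertwine the
multiplications by `λ` and `μ` with the same operators. -/
theorem hom_ext_two {f g : PolynomialModule F (PolynomialModule F M) →ₗ[F] P}
    (A B : Module.End F P) (hfA : ∀ p, f (mulLam F M p) = A (f p))
    (hfB : ∀ p, f (mulMu F M p) = B (f p)) (hgA : ∀ p, g (mulLam F M p) = A (g p))
    (hgB : ∀ p, g (mulMu F M p) = B (g p)) (h : ∀ x, f (constTwo x) = g (constTwo x))
    (p : PolynomialModule F (PolynomialModule F M)) : f p = g p := by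
  induction p using PolynomialModule.induction_linear with
  | zero => rw [map_zero, map_zero]
  | add p q hp hq => rw [map_add, map_add, hp, hq]
  | single j u =>
    induction j with
    | succ j ih =>
      rw [← mulVar_single, ← mulMu, hfB, hgB, ih]
    | zero =>
      induction u using PolynomialModule.induction_linear with
      | zero => rw [PolynomialModule.single_zero, map_zero, map_zero]
      | add p q hp hq => rw [PolynomialModule.single_add, map_add, map_add, hp, hq]
      | single k x =>
        induction k with
        | zero => exact h x
        | succ k ih =>
          rw [← mulVar_single, ← PolynomialModule.map_single, ← mulLam, hfA, hgA, ih]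

end TwoVariables

/-! ### Cyclic permutations of the variables and of the tensor factors -/

section Cyclic

variable {F V : Type*} [Field F] [Ring V] [Algebra F V] (d : NCDerivation F V)

/-- The derivation of the second and of the third tensor factor of `V ⊗ V ⊗ V`. -/
def NCDerivation.sndThird : Module.End F (V ⊗[F] (V ⊗[F] V)) :=
  TensorProduct.map LinearMap.id d.tensor

/-- `∂` on `V ⊗ V ⊗ V`. -/
def NCDerivation.tensorThree : Module.End F (V ⊗[F] (V ⊗[F] V)) :=
  TensorProduct.map d.toLinearMap LinearMap.id + d.sndThird

variable (F V) in
/-- The cyclic permutation `a ⊗ b ⊗ c ↦ b ⊗ c ⊗ a`. -/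
def rotate : V ⊗[F] (V ⊗[F] V) →ₗ[F] V ⊗[F] (V ⊗[F] V) :=
  (TensorProduct.assoc F V V V).toLinearMap ∘ₗ (TensorProduct.comm F V (V ⊗[F] V)).toLinearMap

theorem rotate_tmul (a b c : V) :
    rotate F V (a ⊗ₜ[F] (b ⊗ₜ[F] c)) = b ⊗ₜ[F] (c ⊗ₜ[F] a) := rfl

theorem rotate_tensorThree (x : V ⊗[F] (V ⊗[F] V)) :
    rotate F V (d.tensorThree x) = d.tensorThree (rotate F V x) := by
  refine LinearMap.congr_fun (f := rotate F V ∘ₗ d.tensorThree)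
    (g := d.tensorThree ∘ₗ rotate F V) ?_ x
  ext a b c
  simp [NCDerivation.tensorThree, NCDerivation.sndThird, NCDerivation.tensor, rotate_tmul,
    TensorProduct.tmul_add]
  abel

theorem rotate_rotate_rotate (x : V ⊗[F] (V ⊗[F] V)) :
    rotate F V (rotate F V (rotate F V x)) = x := by
  refine LinearMap.congr_fun (f := rotate F V ∘ₗ rotate F V ∘ₗ rotate F V)
    (g := LinearMap.id) ?_ x
  ext a b c
  simp [rotate_tmul]

/-- The total derivative `λ + μ + ∂` on `V^{⊗3}[λ, μ]`. -/
def totalTwo : Module.End F (PolynomialModule F (PolynomialModule F (V ⊗[F] (V ⊗[F] V)))) :=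
  mulLam F _ + mulMu F _ + mapTwo d.tensorThree

/-- The cyclic permutation of the variables `λ`, `μ`, `-λ-μ-∂` and of the tensor factors: `λ` is
replaced by `μ`, and `μ` by `-λ-μ-∂`. -/
def cycleOne : Module.End F (PolynomialModule F (PolynomialModule F (V ⊗[F] (V ⊗[F] V)))) :=
  subst (-totalTwo d) (inclMu F _ ∘ₗ PolynomialModule.map F (rotate F V ∘ₗ rotate F V))

/-- The inverse cyclic permutation: `μ` is replaced by `λ`, and `λ` by `-λ-μ-∂`. -/
def cycleTwo : Module.End F (PolynomialModule F (PolynomialModule F (V ⊗[F] (V ⊗[F] V)))) :=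
  subst (mulLam F _)
    (evalLamAddMu F _ ∘ₗ skewSubst d.tensorThree ∘ₗ PolynomialModule.map F (rotate F V))

variable {d}
variable (p : PolynomialModule F (PolynomialModule F (V ⊗[F] (V ⊗[F] V))))

theorem totalTwo_apply :
    totalTwo d p = mulLam F _ p + mulMu F _ p + mapTwo d.tensorThree p := rfl

theorem totalTwo_mulLam : totalTwo d (mulLam F _ p) = mulLam F _ (totalTwo d p) := by
  simp only [totalTwo_apply, map_add, mulLam_mulMu, mapTwo_mulLam]

theorem totalTwo_mulMu : totalTwo d (mulMu F _ p) = mulMu F _ (totalTwo d p) := by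
  simp only [totalTwo_apply, map_add, mulLam_mulMu, mapTwo_mulMu]

theorem totalTwo_mapTwo :
    totalTwo d (mapTwo d.tensorThree p) = mapTwo d.tensorThree (totalTwo d p) := by
  simp only [totalTwo_apply, map_add, mapTwo_mulLam, mapTwo_mulMu]

theorem cycleOne_mulMu : cycleOne d (mulMu F _ p) = -totalTwo d (cycleOne d p) :=
  subst_mulVar _ _ p

theorem cycleOne_mulLam : cycleOne d (mulLam F _ p) = mulMu F _ (cycleOne d p) :=
  subst_map_comm
    (fun x => by rw [LinearMap.comp_apply, map_mulVar, inclMu_mulVar]; rfl)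
    (fun y => by rw [LinearMap.neg_apply, map_neg, LinearMap.neg_apply, totalTwo_mulMu]) p

theorem cycleOne_mapTwo :
    cycleOne d (mapTwo d.tensorThree p) = mapTwo d.tensorThree (cycleOne d p) :=
  subst_map_comm
    (fun x => by
      rw [LinearMap.comp_apply, LinearMap.comp_apply, ← inclMu_map]
      congr 1
      exact polyMap_comm (fun x => by
        rw [LinearMap.comp_apply, rotate_tensorThree, rotate_tensorThree]; rfl) x)
    (fun y => by rw [LinearMap.neg_apply, map_neg, LinearMap.neg_apply, totalTwo_mapTwo]) p

theorem cycleOne_constTwo (x : V ⊗[F] (V ⊗[F] V)) :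
    cycleOne d (constTwo x) = constTwo (rotate F V (rotate F V x)) := by
  rw [cycleOne, constTwo, subst_single_zero, LinearMap.comp_apply, PolynomialModule.map_single,
    inclMu_single]
  rfl

theorem cycleTwo_mulMu : cycleTwo d (mulMu F _ p) = mulLam F _ (cycleTwo d p) :=
  subst_mulVar _ _ p

theorem cycleTwo_mulLam : cycleTwo d (mulLam F _ p) = -totalTwo d (cycleTwo d p) :=
  subst_map_comm (D' := -totalTwo d)
    (fun x => by
      simp only [LinearMap.comp_apply]
      rw [map_mulVar, skewSubst_mulVar, varAdd_apply, map_neg, map_add, evalLamAddMu_mulVar,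
        evalLamAddMu_map]
      rfl)
    (fun y => by rw [LinearMap.neg_apply, LinearMap.neg_apply, map_neg, totalTwo_mulLam]) p

theorem cycleTwo_constTwo (x : V ⊗[F] (V ⊗[F] V)) :
    cycleTwo d (constTwo x) = constTwo (rotate F V x) := by
  rw [cycleTwo, constTwo, subst_single_zero]
  simp only [LinearMap.comp_apply]
  rw [PolynomialModule.map_single, skewSubst_single_zero, evalLamAddMu_single]

theorem cycleOne_totalTwo : cycleOne d (totalTwo d p) = -mulLam F _ (cycleOne d p) := by
  rw [totalTwo_apply, map_add, map_add, cycleOne_mulLam, cycleOne_mulMu, cycleOne_mapTwo,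
    totalTwo_apply]
  abel

theorem cycleOne_cycleOne : cycleOne d (cycleOne d p) = cycleTwo d p := by
  refine hom_ext_two (f := cycleOne d ∘ₗ cycleOne d) (g := cycleTwo d)
    (-totalTwo d) (mulLam F _) (fun p => ?_) (fun p => ?_) (cycleTwo_mulLam) cycleTwo_mulMu
    (fun x => ?_) p
  · simp only [LinearMap.comp_apply, cycleOne_mulLam, cycleOne_mulMu, LinearMap.neg_apply]
  · simp only [LinearMap.comp_apply, cycleOne_mulMu, map_neg, cycleOne_totalTwo, neg_neg]
  · simp only [LinearMap.comp_apply, cycleOne_constTwo, cycleTwo_constTwo, rotate_rotate_rotate]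

theorem cycleOne_cycleTwo : cycleOne d (cycleTwo d p) = p := by
  refine hom_ext_two (f := cycleOne d ∘ₗ cycleTwo d) (g := LinearMap.id)
    (mulLam F _) (mulMu F _) (fun p => ?_) (fun p => ?_) (fun _ => rfl) (fun _ => rfl)
    (fun x => ?_) p
  · simp only [LinearMap.comp_apply, cycleTwo_mulLam, map_neg, cycleOne_totalTwo, neg_neg]
  · simp only [LinearMap.comp_apply, cycleTwo_mulMu, cycleOne_mulLam]
  · simp only [LinearMap.comp_apply, cycleOne_constTwo, cycleTwo_constTwo, rotate_rotate_rotate,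
      LinearMap.id_apply]

end Cyclic

/-! ### Extension of skewsymmetry to products -/

section Bracket

variable {F V : Type*} [Field F] [Ring V] [Algebra F V] {d : NCDerivation F V}

theorem NCDerivation.leibniz (d : NCDerivation F V) (a b : V) :
    d.toLinearMap (a * b) = d.toLinearMap a * b + a * d.toLinearMap b := d.leibniz' a b

theorem NCDerivation.tensor_tmul (a b : V) : d.tensor (a ⊗ₜ[F] b) =
    d.toLinearMap a ⊗ₜ[F] b + a ⊗ₜ[F] d.toLinearMap b := by
  simp [NCDerivation.tensor]

theorem tensor_comm (x : V ⊗[F] V) :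
    TensorProduct.comm F V V (d.tensor x) = d.tensor (TensorProduct.comm F V V x) := by
  induction x using TensorProduct.induction_on with
  | zero => simp only [map_zero]
  | add x y hx hy => simp only [map_add, hx, hy]
  | tmul a b =>
    rw [NCDerivation.tensor_tmul, map_add, TensorProduct.comm_tmul, TensorProduct.comm_tmul,
      TensorProduct.comm_tmul, NCDerivation.tensor_tmul, add_comm]

namespace LambdaBracket

variable (B : LambdaBracket d)

theorem br_one (a : V) : B.br a 1 = 0 := by
  have h := B.leibniz_right a 1 1
  rw [mul_one, show outerRight F V 1 = LinearMap.id from by ext; simp [outerRight],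
    show outerLeft F V 1 = LinearMap.id from by ext; simp [outerLeft], polyMap_id] at h
  simpa using h

theorem br_algebraMap (a : V) (r : F) : B.br a (algebraMap F V r) = 0 := by
  rw [Algebra.algebraMap_eq_smul_one, map_smul, br_one, smul_zero]

/-- The right side of the skewsymmetry axiom, `-{{b_{-λ-∂} a}}^σ`, as a function of
`{{b_λ a}}`. -/
def skewOp (d : NCDerivation F V) : Module.End F (PolynomialModule F (V ⊗[F] V)) :=
  -PolynomialModule.map F (TensorProduct.comm F V V).toLinearMap ∘ₗ skewSubst d.tensor

theorem skewOp_apply (p : PolynomialModule F (V ⊗[F] V)) : skewOp d p =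
    -PolynomialModule.map F (TensorProduct.comm F V V).toLinearMap (skewSubst d.tensor p) := rfl

theorem skewSubst_comm (p : PolynomialModule F (V ⊗[F] V)) :
    skewSubst d.tensor (PolynomialModule.map F (TensorProduct.comm F V V).toLinearMap p) =
      PolynomialModule.map F (TensorProduct.comm F V V).toLinearMap (skewSubst d.tensor p) :=
  skewSubst_map tensor_comm p

theorem polyMap_comm_comm (p : PolynomialModule F (V ⊗[F] V)) :
    PolynomialModule.map F (TensorProduct.comm F V V).toLinearMap
      (PolynomialModule.map F (TensorProduct.comm F V V).toLinearMap p) = p := by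
  rw [polyMap_map, show (TensorProduct.comm F V V).toLinearMap ∘ₗ
    (TensorProduct.comm F V V).toLinearMap = LinearMap.id from by ext; simp, polyMap_id]

theorem skewOp_skewOp (p : PolynomialModule F (V ⊗[F] V)) : skewOp d (skewOp d p) = p := by
  rw [skewOp_apply, skewOp_apply, map_neg, map_neg, neg_neg, skewSubst_comm, polyMap_comm_comm,
    skewSubst_skewSubst]

theorem skewOp_mulVar (p : PolynomialModule F (V ⊗[F] V)) :
    skewOp d (-mulVar F _ p) = varAdd d.tensor (skewOp d p) := by
  rw [skewOp_apply, skewOp_apply, map_neg, map_neg, neg_neg, skewSubst_mulVar, map_neg, map_neg,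
    map_varAdd tensor_comm]

theorem tensor_starOneRight (x : V ⊗[F] V) (y : V) : d.tensor (starOneRight F V x y) =
    starOneRight F V (d.tensor x) y + starOneRight F V x (d.toLinearMap y) := by
  induction x using TensorProduct.induction_on with
  | zero => simp only [map_zero, LinearMap.zero_apply, add_zero]
  | add x z hx hz => simp only [map_add, LinearMap.add_apply, hx, hz]; abel
  | tmul a b =>
    simp only [starOneRight_tmul, NCDerivation.tensor_tmul, map_add, LinearMap.add_apply,
      NCDerivation.leibniz, TensorProduct.add_tmul]
    abel

theorem tensor_starOneLeft (x : V ⊗[F] V) (y : V) : d.tensor (starOneLeft F V x y) =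
    starOneLeft F V (d.tensor x) y + starOneLeft F V x (d.toLinearMap y) := by
  induction x using TensorProduct.induction_on with
  | zero => simp only [map_zero, LinearMap.zero_apply, add_zero]
  | add x z hx hz => simp only [map_add, LinearMap.add_apply, hx, hz]; abel
  | tmul a b =>
    simp only [starOneLeft_tmul, NCDerivation.tensor_tmul, map_add, LinearMap.add_apply,
      NCDerivation.leibniz, TensorProduct.tmul_add]
    abel

/-- `skewOp` turns the first term of the left Leibniz rule into that of the right Leibniz rule. -/
theorem skewOp_arrow_right (p : PolynomialModule F (V ⊗[F] V)) (y : V) :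
    skewOp d (arrow d.toLinearMap (starOneRight F V) p y) =
      PolynomialModule.map F (outerRight F V y) (skewOp d p) := by
  rw [skewOp_apply, skewSubst_arrow tensor_starOneRight, skewOp_apply, map_neg]
  congr 1
  refine polyMap_comm (fun x => ?_) _
  induction x using TensorProduct.induction_on with
  | zero => simp only [map_zero]
  | add x z hx hz => simp only [map_add, hx, hz]
  | tmul a b => simp [starOneRight_tmul, outerRight]

/-- `skewOp` turns the second term of the left Leibniz rule into that of the right Leibniz rule. -/
theorem skewOp_arrow_left (p : PolynomialModule F (V ⊗[F] V)) (y : V) :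
    skewOp d (arrow d.toLinearMap (starOneLeft F V) p y) =
      PolynomialModule.map F (outerLeft F V y) (skewOp d p) := by
  rw [skewOp_apply, skewSubst_arrow tensor_starOneLeft, skewOp_apply, map_neg]
  congr 1
  refine polyMap_comm (fun x => ?_) _
  induction x using TensorProduct.induction_on with
  | zero => simp only [map_zero]
  | add x z hx hz => simp only [map_add, hx, hz]
  | tmul a b => simp [starOneLeft_tmul, outerLeft]

theorem one_br (b : V) : B.br 1 b = 0 := by
  -- The arrow products with `1` are the identity, since the involution `skewOp` turns them into
  -- the outer actions of `1`.
  have hr : ∀ p, arrow d.toLinearMap (starOneRight F V) p 1 = p := by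
    intro p
    have := skewOp_arrow_right (d := d) p 1
    rw [show outerRight F V 1 = LinearMap.id from by ext; simp [outerRight], polyMap_id] at this
    rw [← skewOp_skewOp (d := d) (arrow _ _ _ _), this, skewOp_skewOp]
  have hl : ∀ p, arrow d.toLinearMap (starOneLeft F V) p 1 = p := by
    intro p
    have := skewOp_arrow_left (d := d) p 1
    rw [show outerLeft F V 1 = LinearMap.id from by ext; simp [outerLeft], polyMap_id] at this
    rw [← skewOp_skewOp (d := d) (arrow _ _ _ _), this, skewOp_skewOp]
  have h := B.leibniz_left 1 1 b
  rw [mul_one, hr, hl] at h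
  simpa using h

theorem algebraMap_br (r : F) (b : V) : B.br (algebraMap F V r) b = 0 := by
  rw [Algebra.algebraMap_eq_smul_one, map_smul, LinearMap.smul_apply, one_br, smul_zero]

/-- The elements that satisfy skewsymmetry with a given `a` form a subalgebra. -/
def skewSubalgebra (a : V) : Subalgebra F V where
  carrier := {b | B.br a b = skewOp d (B.br b a)}
  add_mem' {b c} hb hc := by
    simp only [Set.mem_ofPred_eq, map_add, LinearMap.add_apply] at hb hc ⊢
    rw [hb, hc]
  mul_mem' {b c} hb hc := by
    simp only [Set.mem_ofPred_eq] at hb hc ⊢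
    rw [B.leibniz_right, B.leibniz_left, map_add, skewOp_arrow_right, skewOp_arrow_left, hb, hc]
  algebraMap_mem' r := by
    simp only [Set.mem_ofPred_eq]
    rw [br_algebraMap, algebraMap_br, map_zero]

/-- Skewsymmetry extends from generators to the second argument, and then to the first one because
`skewOp` is an involution. -/
theorem skew_of_generators {a : ℤ → V}
    (hgen : ∀ S : Subalgebra F V, (∀ x ∈ S, d.toLinearMap x ∈ S) → (∀ n, a n ∈ S) → S = ⊤)
    (ha : ∀ p q, B.br (a p) (a q) = skewOp d (B.br (a q) (a p))) (x y : V) :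
    B.br x y = skewOp d (B.br y x) := by
  have hd : ∀ x, ∀ y ∈ B.skewSubalgebra x, d.toLinearMap y ∈ B.skewSubalgebra x := by
    intro x y hy
    change B.br x y = _ at hy
    change B.br x _ = _
    rw [B.sesqui_right, B.sesqui_left, skewOp_mulVar, hy]
  have h2 : ∀ p y, B.br (a p) y = skewOp d (B.br y (a p)) := by
    intro p y
    have : y ∈ B.skewSubalgebra (a p) := by
      rw [hgen _ (hd (a p)) (ha p)]
      trivial
    exact this
  have : y ∈ B.skewSubalgebra x := by
    rw [hgen _ (hd x) fun p => ?_]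
    · trivial
    · change B.br x (a p) = _
      rw [h2, skewOp_skewOp]
  exact this

/-! ### The Jacobiator and its cyclic symmetry -/

/-- `{{a_λ {{b_μ c}}}}_L`. -/
def nestedL (a b c : V) : PolynomialModule F (PolynomialModule F (V ⊗[F] (V ⊗[F] V))) :=
  PolynomialModule.map F (B.brL a) (B.br b c)

/-- The difference of the two sides of the Jacobi identity. -/
def jacobiator (a b c : V) : PolynomialModule F (PolynomialModule F (V ⊗[F] (V ⊗[F] V))) :=
  B.nestedL a b c - subst (mulLam F _) (inclMu F _ ∘ₗ B.brR b) (B.br a c) -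
    subst (mulLam F _) (evalLamAddMu F _ ∘ₗ B.brOuterL c) (B.br a b)

theorem brL_tensor (b : V) (x : V ⊗[F] V) :
    B.brL b (d.tensor x) = varAdd d.tensorThree (B.brL b x) := by
  induction x using TensorProduct.induction_on with
  | zero => simp only [map_zero]
  | add x z hx hz => simp only [map_add, hx, hz]
  | tmul x y =>
    have h : d.tensorThree ∘ₗ appendRight F V y =
        appendRight F V y ∘ₗ d.tensor + appendRight F V (d.toLinearMap y) := by
      ext u v
      simp [NCDerivation.tensorThree, NCDerivation.sndThird, NCDerivation.tensor_tmul,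
        appendRight_tmul, TensorProduct.tmul_add, add_assoc]
    rw [NCDerivation.tensor_tmul, map_add, brL_tmul, brL_tmul, brL_tmul, B.sesqui_right,
      varAdd_apply, varAdd_apply, map_add, map_mulVar, polyMap_map, polyMap_map, h, map_add_map,
      LinearMap.add_apply, add_assoc]

theorem brR_comm (b : V) (x : V ⊗[F] V) : B.brR b (TensorProduct.comm F V V x) =
    PolynomialModule.map F (rotate F V ∘ₗ rotate F V) (B.brL b x) := by
  induction x using TensorProduct.induction_on with
  | zero => simp only [map_zero]
  | add x z hx hz => simp only [map_add, hx, hz]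
  | tmul x y =>
    rw [TensorProduct.comm_tmul, brR_tmul, brL_tmul, polyMap_map]
    congr 2
    ext u v
    simp [appendRight_tmul, rotate_tmul]

theorem tensorThree_insertMid (x : V ⊗[F] V) (y : V) : d.tensorThree (insertMid F V x y) =
    insertMid F V (d.tensor x) y + insertMid F V x (d.toLinearMap y) := by
  induction x using TensorProduct.induction_on with
  | zero => simp only [map_zero, LinearMap.zero_apply, add_zero]
  | add x z hx hz => simp only [map_add, LinearMap.add_apply, hx, hz]; abel
  | tmul u v =>
    simp only [insertMid_tmul, NCDerivation.tensorThree, NCDerivation.sndThird,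
      NCDerivation.tensor_tmul, map_add, LinearMap.add_apply, TensorProduct.map_tmul,
      LinearMap.id_apply, TensorProduct.tmul_add]
    abel

/-- By skewsymmetry, `{{x_λ c}}_L` on a tensor is a cyclic permutation of `{{c_λ x}}_L`. -/
theorem brOuterL_eq (hs : ∀ a b, B.br a b = skewOp d (B.br b a)) (c : V) (x : V ⊗[F] V) :
    B.brOuterL c x =
      -skewSubst d.tensorThree (PolynomialModule.map F (rotate F V) (B.brL c x)) := by
  induction x using TensorProduct.induction_on with
  | zero => simp only [map_zero, neg_zero]
  | add x z hx hz => simp only [map_add, hx, hz]; abel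
  | tmul x y =>
    rw [brOuterL_tmul, brL_tmul, hs x c, skewOp_apply, map_neg, LinearMap.neg_apply, neg_inj,
      ← skewSubst_skewSubst d.tensorThree (arrow _ _ _ _), skewSubst_arrow tensorThree_insertMid,
      ← skewSubst_comm, skewSubst_skewSubst]
    congr 1
    refine polyMap_comm (fun x => ?_) _
    induction x using TensorProduct.induction_on with
    | zero => simp only [map_zero]
    | add x z hx hz => simp only [map_add, hx, hz]
    | tmul u v => simp [appendRight_tmul, rotate_tmul, insertMid_tmul]

theorem subst_inclMu_skewSubst {f : V ⊗[F] V →ₗ[F] PolynomialModule F (V ⊗[F] (V ⊗[F] V))}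
    (hf : ∀ x, f (d.tensor x) = varAdd d.tensorThree (f x)) (p : PolynomialModule F (V ⊗[F] V)) :
    subst (mulLam F _) (inclMu F _ ∘ₗ f) (skewSubst d.tensor p) =
      subst (-totalTwo d) (inclMu F _ ∘ₗ f) p := by
  rw [skewSubst, apply_subst (T' := -totalTwo d)]
  · congr 1
    congr 1
    refine LinearMap.ext fun x => ?_
    rw [LinearMap.comp_apply, lsingle_eq_single, subst_single_zero]
  · intro x
    rw [LinearMap.neg_apply, map_neg, LinearMap.neg_apply,
      subst_varAdd (D' := muAdd d.tensorThree) _ (muAdd_mulLam _), totalTwo, muAdd, add_assoc]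
    intro x
    rw [LinearMap.comp_apply, hf, inclMu_varAdd]
    rfl

theorem subst_brR (hs : ∀ a b, B.br a b = skewOp d (B.br b a)) (a b c : V) :
    subst (mulLam F _) (inclMu F _ ∘ₗ B.brR b) (B.br a c) =
      -cycleOne d (B.nestedL b c a) := by
  have h : ∀ x, (PolynomialModule.map F (rotate F V ∘ₗ rotate F V) ∘ₗ B.brL b) (d.tensor x) =
      varAdd d.tensorThree
        ((PolynomialModule.map F (rotate F V ∘ₗ rotate F V) ∘ₗ B.brL b) x) := by
    intro x
    rw [LinearMap.comp_apply, brL_tensor, map_varAdd (D' := d.tensorThree)]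
    · rfl
    · intro x
      rw [LinearMap.comp_apply, rotate_tensorThree, rotate_tensorThree]
      rfl
  have h' : B.brR b ∘ₗ (TensorProduct.comm F V V).toLinearMap =
      PolynomialModule.map F (rotate F V ∘ₗ rotate F V) ∘ₗ B.brL b :=
    LinearMap.ext (B.brR_comm b)
  rw [hs a c, skewOp_apply, map_neg, neg_inj, subst_map, LinearMap.comp_assoc, h',
    subst_inclMu_skewSubst h, cycleOne, nestedL, subst_map]
  rfl

theorem subst_brOuterL (hs : ∀ a b, B.br a b = skewOp d (B.br b a)) (a b c : V) :
    subst (mulLam F _) (evalLamAddMu F _ ∘ₗ B.brOuterL c) (B.br a b) =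
      -cycleTwo d (B.nestedL c a b) := by
  have h : evalLamAddMu F _ ∘ₗ B.brOuterL c =
      -((evalLamAddMu F _ ∘ₗ skewSubst d.tensorThree ∘ₗ PolynomialModule.map F (rotate F V)) ∘ₗ
        B.brL c) := by
    refine LinearMap.ext fun x => ?_
    rw [LinearMap.comp_apply, brOuterL_eq B hs, map_neg]
    rfl
  rw [cycleTwo, nestedL, subst_map, h, subst_neg_comp]

/-- By skewsymmetry, the Jacobiator is the sum of the cyclic permutations of
`{{a_λ {{b_μ c}}}}_L`. -/
theorem jacobiator_eq (hs : ∀ a b, B.br a b = skewOp d (B.br b a)) (a b c : V) :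
    B.jacobiator a b c =
      B.nestedL a b c + cycleOne d (B.nestedL b c a) + cycleTwo d (B.nestedL c a b) := by
  rw [jacobiator, B.subst_brR hs, B.subst_brOuterL hs]
  abel

theorem jacobiator_cyclic (hs : ∀ a b, B.br a b = skewOp d (B.br b a)) (a b c : V) :
    B.jacobiator a b c = cycleOne d (B.jacobiator b c a) := by
  rw [jacobiator_eq B hs, jacobiator_eq B hs, map_add, map_add, cycleOne_cycleOne,
    cycleOne_cycleTwo]
  abel

end LambdaBracket

end Bracket

/-! ### The Jacobiator as a derivation in its last argument -/

section Derivation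

variable {F V : Type*} [Field F] [Ring V] [Algebra F V] {d : NCDerivation F V}

variable (F V) in
/-- `(a ⊗ b ⊗ c) y = a ⊗ b ⊗ c y`. -/
def outerRightThree (y : V) : Module.End F (V ⊗[F] (V ⊗[F] V)) :=
  TensorProduct.map LinearMap.id (outerRight F V y)

variable (F V) in
/-- `x (a ⊗ b ⊗ c) = x a ⊗ b ⊗ c`. -/
def outerLeftThree (x : V) : Module.End F (V ⊗[F] (V ⊗[F] V)) :=
  TensorProduct.map (LinearMap.mulLeft F x) LinearMap.id

variable (F V) in
/-- The product `(a ⊗ b) ⊗ (x ⊗ y) ↦ a ⊗ b x ⊗ y`. -/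
def midMul : V ⊗[F] V →ₗ[F] V ⊗[F] V →ₗ[F] V ⊗[F] (V ⊗[F] V) :=
  (LinearMap.mul F (V ⊗[F] (V ⊗[F] V))).compl₁₂ (appendRight F V 1)
    (TensorProduct.mk F V (V ⊗[F] V) 1)

theorem midMul_tmul (a b x y : V) :
    midMul F V (a ⊗ₜ[F] b) (x ⊗ₜ[F] y) = a ⊗ₜ[F] ((b * x) ⊗ₜ[F] y) := by
  simp [midMul, appendRight_tmul]

theorem midMul_tmul_right (g : V ⊗[F] V) (x y : V) :
    midMul F V g (x ⊗ₜ[F] y) = appendRight F V y (outerRight F V x g) := by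
  induction g using TensorProduct.induction_on with
  | zero => simp only [map_zero, LinearMap.zero_apply]
  | add x z hx hz => simp only [map_add, LinearMap.add_apply, hx, hz]
  | tmul a b => simp [midMul_tmul, outerRight, appendRight_tmul]

theorem midMul_tmul_left (h : V ⊗[F] V) (a b : V) :
    midMul F V (a ⊗ₜ[F] b) h = a ⊗ₜ[F] (outerLeft F V b h) := by
  induction h using TensorProduct.induction_on with
  | zero => simp only [map_zero, TensorProduct.tmul_zero]
  | add x z hx hz => simp only [map_add, TensorProduct.tmul_add, hx, hz]
  | tmul a b => simp [midMul_tmul, outerLeft]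

theorem mulLam_pow_single {M : Type*} [AddCommGroup M] [Module F M] (i j : ℕ) (x : M) :
    (mulLam F M ^ i) (PolynomialModule.single F j (PolynomialModule.single F 0 x)) =
      PolynomialModule.single F j (PolynomialModule.single F i x) := by
  induction i with
  | zero => rfl
  | succ i ih =>
    rw [pow_succ', Module.End.mul_apply, ih, mulLam, PolynomialModule.map_single, mulVar_single]

/-- The cross terms in the Leibniz rule for the two nested brackets agree. -/
theorem map_flip_eq_subst (κ : V ⊗[F] V →ₗ[F] V ⊗[F] V →ₗ[F] V ⊗[F] (V ⊗[F] V))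
    (p r : PolynomialModule F (V ⊗[F] V)) :
    PolynomialModule.map F (mapHom.flip p ∘ₗ κ.flip) r =
      subst (mulLam F _) (inclMu F _ ∘ₗ mapHom.flip r ∘ₗ κ) p := by
  induction p using PolynomialModule.induction_linear with
  | zero => rw [map_zero, map_zero, LinearMap.zero_comp, polyMap_zero, LinearMap.zero_apply]
  | add p q hp hq =>
    rw [map_add, map_add, LinearMap.add_comp, map_add_map, LinearMap.add_apply, hp, hq]
  | single i g =>
    rw [subst_single]
    induction r using PolynomialModule.induction_linear with
    | zero => simp only [map_zero, LinearMap.zero_comp, LinearMap.comp_zero, LinearMap.zero_apply]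
    | add r q hr hq =>
      simp only [map_add, LinearMap.add_comp, LinearMap.comp_add, LinearMap.add_apply, hr, hq]
    | single j h =>
      have h1 : (inclMu F _ ∘ₗ mapHom.flip (PolynomialModule.single F j h) ∘ₗ κ) g =
          PolynomialModule.single F j (PolynomialModule.single F 0 (κ g h)) := by
        simp [mapHom, inclMu, lsingle_eq_single]
      rw [h1, mulLam_pow_single, PolynomialModule.map_single]
      simp [mapHom]

namespace LambdaBracket

variable (B : LambdaBracket d)

theorem brL_outerRight (a y : V) (x : V ⊗[F] V) :
    B.brL a (outerRight F V y x) = PolynomialModule.map F (outerRightThree F V y) (B.brL a x) := by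
  induction x using TensorProduct.induction_on with
  | zero => simp only [map_zero]
  | add x z hx hz => simp only [map_add, hx, hz]
  | tmul u v =>
    rw [outerRight, TensorProduct.map_tmul, brL_tmul, brL_tmul, polyMap_map]
    congr 2
    ext s t
    simp [appendRight_tmul, outerRightThree, outerRight]

theorem brL_outerLeft (a c : V) (x : V ⊗[F] V) :
    B.brL a (outerLeft F V c x) = PolynomialModule.map F (outerLeftThree F V c) (B.brL a x) +
      (mapHom.flip (B.br a c) ∘ₗ (midMul F V).flip) x := by
  induction x using TensorProduct.induction_on with
  | zero => simp only [map_zero, add_zero]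
  | add x z hx hz => simp only [map_add, hx, hz]; abel
  | tmul u v =>
    rw [outerLeft, TensorProduct.map_tmul, brL_tmul, brL_tmul, LinearMap.mulLeft_apply,
      B.leibniz_right, map_add, polyMap_map, polyMap_map, polyMap_map, add_comm]
    congr 1
    · congr 2
      ext s t
      simp [appendRight_tmul, outerLeftThree, outerLeft]
    · change PolynomialModule.map F (appendRight F V v ∘ₗ outerRight F V u) (B.br a c) =
        PolynomialModule.map F ((midMul F V).flip (u ⊗ₜ[F] v)) (B.br a c)
      rw [show appendRight F V v ∘ₗ outerRight F V u = (midMul F V).flip (u ⊗ₜ[F] v) from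
        LinearMap.ext fun s => (midMul_tmul_right s u v).symm]

theorem brR_outerLeft (b c : V) (x : V ⊗[F] V) :
    B.brR b (outerLeft F V c x) =
      PolynomialModule.map F (outerLeftThree F V c) (B.brR b x) := by
  induction x using TensorProduct.induction_on with
  | zero => simp only [map_zero]
  | add x z hx hz => simp only [map_add, hx, hz]
  | tmul u v =>
    rw [outerLeft, TensorProduct.map_tmul, brR_tmul, brR_tmul, polyMap_map]
    congr 2

theorem brR_outerRight (b y : V) (x : V ⊗[F] V) :
    B.brR b (outerRight F V y x) = PolynomialModule.map F (outerRightThree F V y) (B.brR b x) +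
      (mapHom.flip (B.br b y) ∘ₗ midMul F V) x := by
  induction x using TensorProduct.induction_on with
  | zero => simp only [map_zero, add_zero]
  | add x z hx hz => simp only [map_add, hx, hz]; abel
  | tmul u v =>
    rw [outerRight, TensorProduct.map_tmul, brR_tmul, brR_tmul, LinearMap.mulRight_apply,
      B.leibniz_right, map_add, polyMap_map, polyMap_map, polyMap_map]
    congr 1
    change PolynomialModule.map F (TensorProduct.mk F V (V ⊗[F] V) u ∘ₗ outerLeft F V v)
      (B.br b y) = PolynomialModule.map F (midMul F V (u ⊗ₜ[F] v)) (B.br b y)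
    rw [show TensorProduct.mk F V (V ⊗[F] V) u ∘ₗ outerLeft F V v = midMul F V (u ⊗ₜ[F] v) from
      LinearMap.ext fun s => (midMul_tmul_left s u v).symm]

theorem brOuterL_mul (b c : V) (x : V ⊗[F] V) : B.brOuterL (b * c) x =
    PolynomialModule.map F (outerRightThree F V c) (B.brOuterL b x) +
      PolynomialModule.map F (outerLeftThree F V b) (B.brOuterL c x) := by
  induction x using TensorProduct.induction_on with
  | zero => simp only [map_zero, add_zero]
  | add x z hx hz => simp only [map_add, hx, hz]; abel
  | tmul u v =>
    rw [brOuterL_tmul, brOuterL_tmul, brOuterL_tmul, B.leibniz_right, map_add,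
      LinearMap.add_apply, map_arrow (β' := insertMid F V) (f := outerRight F V c),
      map_arrow (β' := insertMid F V) (f := outerLeft F V b)]
    · intro x y
      induction x using TensorProduct.induction_on with
      | zero => simp only [map_zero, LinearMap.zero_apply]
      | add x z hx hz => simp only [map_add, LinearMap.add_apply, hx, hz]
      | tmul s t => simp [insertMid_tmul, outerLeftThree, outerLeft]
    · intro x y
      induction x using TensorProduct.induction_on with
      | zero => simp only [map_zero, LinearMap.zero_apply]
      | add x z hx hz => simp only [map_add, LinearMap.add_apply, hx, hz]
      | tmul s t => simp [insertMid_tmul, outerRightThree, outerRight]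

theorem brOuterL_add (b c : V) : B.brOuterL (b + c) = B.brOuterL b + B.brOuterL c := by
  ext u v
  simp [brOuterL_tmul]

theorem brOuterL_algebraMap (r : F) : B.brOuterL (algebraMap F V r) = 0 := by
  ext u v
  simp [brOuterL_tmul, br_algebraMap]

theorem subst_mulLam_mapTwo {M N : Type*} [AddCommGroup M] [Module F M] [AddCommGroup N]
    [Module F N] (f : Module.End F N) (ι : M →ₗ[F] PolynomialModule F (PolynomialModule F N))
    (p : PolynomialModule F M) :
    mapTwo f (subst (mulLam F N) ι p) = subst (mulLam F N) (mapTwo f ∘ₗ ι) p :=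
  apply_subst (mapTwo_mulLam f) p

/-- The cross terms `{{a_λ x}} · {{b_μ y}}` of the first two nested brackets cancel. -/
theorem jacobiator_mul (a b x y : V) : B.jacobiator a b (x * y) =
    mapTwo (outerRightThree F V y) (B.jacobiator a b x) +
      mapTwo (outerLeftThree F V x) (B.jacobiator a b y) := by
  have h1 : B.nestedL a b (x * y) = mapTwo (outerRightThree F V y) (B.nestedL a b x) +
      mapTwo (outerLeftThree F V x) (B.nestedL a b y) +
      PolynomialModule.map F (mapHom.flip (B.br a x) ∘ₗ (midMul F V).flip) (B.br b y) := by
    rw [nestedL, B.leibniz_right, map_add, polyMap_map, polyMap_map,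
      show B.brL a ∘ₗ outerRight F V y = PolynomialModule.map F (outerRightThree F V y) ∘ₗ B.brL a
        from LinearMap.ext (B.brL_outerRight a y),
      show B.brL a ∘ₗ outerLeft F V x = PolynomialModule.map F (outerLeftThree F V x) ∘ₗ B.brL a +
        mapHom.flip (B.br a x) ∘ₗ (midMul F V).flip from LinearMap.ext (B.brL_outerLeft a x),
      map_add_map, LinearMap.add_apply, ← polyMap_map, ← polyMap_map, add_assoc]
    rfl
  have h2 : subst (mulLam F _) (inclMu F _ ∘ₗ B.brR b) (B.br a (x * y)) =
      mapTwo (outerRightThree F V y) (subst (mulLam F _) (inclMu F _ ∘ₗ B.brR b) (B.br a x)) +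
      mapTwo (outerLeftThree F V x) (subst (mulLam F _) (inclMu F _ ∘ₗ B.brR b) (B.br a y)) +
      subst (mulLam F _) (inclMu F _ ∘ₗ mapHom.flip (B.br b y) ∘ₗ midMul F V) (B.br a x) := by
    have e1 : (inclMu F _ ∘ₗ B.brR b) ∘ₗ outerRight F V y =
        mapTwo (outerRightThree F V y) ∘ₗ inclMu F _ ∘ₗ B.brR b +
          inclMu F _ ∘ₗ mapHom.flip (B.br b y) ∘ₗ midMul F V := by
      refine LinearMap.ext fun z => ?_
      simp only [LinearMap.comp_apply, LinearMap.add_apply, brR_outerRight, map_add, inclMu_map]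
    have e2 : (inclMu F _ ∘ₗ B.brR b) ∘ₗ outerLeft F V x =
        mapTwo (outerLeftThree F V x) ∘ₗ inclMu F _ ∘ₗ B.brR b := by
      refine LinearMap.ext fun z => ?_
      simp only [LinearMap.comp_apply, brR_outerLeft, inclMu_map]
    rw [B.leibniz_right, map_add, subst_map, subst_map, e1, e2, subst_comp_add,
      subst_mulLam_mapTwo, subst_mulLam_mapTwo]
    abel
  have h3 : subst (mulLam F _) (evalLamAddMu F _ ∘ₗ B.brOuterL (x * y)) (B.br a b) =
      mapTwo (outerRightThree F V y)
        (subst (mulLam F _) (evalLamAddMu F _ ∘ₗ B.brOuterL x) (B.br a b)) +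
      mapTwo (outerLeftThree F V x)
        (subst (mulLam F _) (evalLamAddMu F _ ∘ₗ B.brOuterL y) (B.br a b)) := by
    have e : evalLamAddMu F _ ∘ₗ B.brOuterL (x * y) =
        mapTwo (outerRightThree F V y) ∘ₗ evalLamAddMu F _ ∘ₗ B.brOuterL x +
        mapTwo (outerLeftThree F V x) ∘ₗ evalLamAddMu F _ ∘ₗ B.brOuterL y := by
      refine LinearMap.ext fun z => ?_
      simp only [LinearMap.comp_apply, LinearMap.add_apply, brOuterL_mul, map_add,
        evalLamAddMu_map]
    rw [e, subst_comp_add, subst_mulLam_mapTwo, subst_mulLam_mapTwo]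
  rw [jacobiator, h1, h2, h3, map_flip_eq_subst, jacobiator, jacobiator]
  simp only [map_sub]
  abel

theorem jacobiator_add (a b x y : V) :
    B.jacobiator a b (x + y) = B.jacobiator a b x + B.jacobiator a b y := by
  simp only [jacobiator, nestedL, map_add, brOuterL_add, LinearMap.comp_add, subst_comp_add]
  abel

theorem jacobiator_algebraMap (a b : V) (r : F) :
    B.jacobiator a b (algebraMap F V r) = 0 := by
  simp only [jacobiator, nestedL, br_algebraMap, map_zero, brOuterL_algebraMap,
    LinearMap.comp_zero, subst_zero_comp, sub_zero]

theorem jacobiator_derivation (a b x : V) :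
    B.jacobiator a b (d.toLinearMap x) = totalTwo d (B.jacobiator a b x) := by
  have h1 : B.nestedL a b (d.toLinearMap x) = totalTwo d (B.nestedL a b x) := by
    have e : B.brL a ∘ₗ d.tensor = varAdd d.tensorThree ∘ₗ B.brL a :=
      LinearMap.ext (B.brL_tensor a)
    rw [nestedL, B.sesqui_right, varAdd_apply, map_add, map_mulVar, polyMap_map, e,
      ← polyMap_map, varAdd, map_add_map, totalTwo_apply, LinearMap.add_apply, ← add_assoc,
      add_comm (mulVar _ _ _)]
    rfl
  have h2 : subst (mulLam F _) (inclMu F _ ∘ₗ B.brR b) (B.br a (d.toLinearMap x)) =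
      totalTwo d (subst (mulLam F _) (inclMu F _ ∘ₗ B.brR b) (B.br a x)) := by
    rw [B.sesqui_right, subst_varAdd (D' := muAdd d.tensorThree) _ (muAdd_mulLam _), totalTwo,
      muAdd, add_assoc]
    intro y
    simp only [LinearMap.comp_apply]
    rw [← inclMu_varAdd]
    congr 1
    induction y using TensorProduct.induction_on with
    | zero => simp only [map_zero]
    | add x z hx hz => simp only [map_add, hx, hz]
    | tmul u v =>
      have e : d.tensorThree ∘ₗ TensorProduct.mk F V (V ⊗[F] V) u =
          TensorProduct.mk F V (V ⊗[F] V) (d.toLinearMap u) +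
            TensorProduct.mk F V (V ⊗[F] V) u ∘ₗ d.tensor := by
        ext s t
        simp [NCDerivation.tensorThree, NCDerivation.sndThird]
      rw [NCDerivation.tensor_tmul, map_add, brR_tmul, brR_tmul, brR_tmul, B.sesqui_right,
        varAdd_apply, varAdd_apply, map_add, map_mulVar, polyMap_map, polyMap_map, e, map_add_map,
        LinearMap.add_apply]
      abel
  have h3 : subst (mulLam F _) (evalLamAddMu F _ ∘ₗ B.brOuterL (d.toLinearMap x)) (B.br a b) =
      totalTwo d (subst (mulLam F _) (evalLamAddMu F _ ∘ₗ B.brOuterL x) (B.br a b)) := by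
    rw [apply_subst totalTwo_mulLam]
    congr 2
    refine LinearMap.ext fun y => ?_
    simp only [LinearMap.comp_apply]
    induction y using TensorProduct.induction_on with
    | zero => simp only [map_zero]
    | add x z hx hz => simp only [map_add, hx, hz]
    | tmul u v =>
      rw [brOuterL_tmul, brOuterL_tmul, B.sesqui_right, arrow_varAdd tensorThree_insertMid,
        varAdd_apply, map_add, evalLamAddMu_mulVar, evalLamAddMu_map]
      rfl
  rw [jacobiator, h1, h2, h3, jacobiator, map_sub, map_sub]

/-- The elements `c` that satisfy the Jacobi identity with given `a` and `b` form a subalgebra. -/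
def jacobiSubalgebra (a b : V) : Subalgebra F V where
  carrier := {c | B.jacobiator a b c = 0}
  add_mem' {x y} hx hy := by
    simp only [Set.mem_ofPred_eq, jacobiator_add] at hx hy ⊢
    rw [hx, hy, add_zero]
  mul_mem' {x y} hx hy := by
    simp only [Set.mem_ofPred_eq, jacobiator_mul] at hx hy ⊢
    rw [hx, hy, map_zero, map_zero, add_zero]
  algebraMap_mem' r := B.jacobiator_algebraMap a b r

/-- The Jacobi identity extends from generators to the last argument, and then, by cyclic symmetry,
to the other ones. -/
theorem jacobi_of_generators {a : ℤ → V}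
    (hgen : ∀ S : Subalgebra F V, (∀ x ∈ S, d.toLinearMap x ∈ S) → (∀ n, a n ∈ S) → S = ⊤)
    (hs : ∀ a b, B.br a b = skewOp d (B.br b a))
    (ha : ∀ p q r, B.jacobiator (a p) (a q) (a r) = 0) (x y z : V) :
    B.jacobiator x y z = 0 := by
  have hcyc : ∀ x y z, B.jacobiator y z x = 0 → B.jacobiator x y z = 0 := by
    intro x y z h
    rw [B.jacobiator_cyclic hs, h, map_zero]
  have key : ∀ x y, (∀ n, B.jacobiator x y (a n) = 0) → ∀ z, B.jacobiator x y z = 0 := by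
    intro x y h z
    have : z ∈ B.jacobiSubalgebra x y := by
      rw [hgen (B.jacobiSubalgebra x y) (fun z hz => ?_) h]
      · trivial
      · change B.jacobiator x y z = 0 at hz
        change B.jacobiator x y _ = 0
        rw [jacobiator_derivation, hz, map_zero]
    exact this
  have h1 : ∀ n, B.jacobiator (a n) x y = 0 := fun n => key (a n) x (fun m =>
    hcyc (a n) x (a m) (hcyc x (a m) (a n) (key (a m) (a n) (ha m n) x))) y
  exact key x y (fun n => hcyc x y (a n) (hcyc y (a n) x (h1 n))) z

end LambdaBracket

end Derivation

/-! ### Skewsymmetry and the Jacobi identity for the generators -/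

/-- The scalar Jacobi identity for commuting elements of a ring, as an identity of finite sums. -/
theorem sum_adlerKernel_jacobi {R : Type*} [Ring R] {s t : R} (hst : Commute s t)
    (n m l p q r lo hi : ℤ) (h1 : lo ≤ q + r + 1 - l) (h2 : lo ≤ p + r + 1 - n)
    (h3 : lo ≤ p + q + 1 - m) (h4 : n + m - 1 - p ≤ hi) (h5 : m + l - 1 - q ≤ hi)
    (h6 : n + l - 1 - r ≤ hi) :
    ∑ x ∈ Finset.Icc lo hi, (adlerKernel t x l q r * adlerKernel s n m p x -
      adlerKernel (s + t) n x p r * adlerKernel t m l q x -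
      adlerKernel s x m p q * adlerKernel (s + t) n l x r) = 0 := by
  -- The commutative case is transported along the evaluation at `s` and `t`.
  have hev : ∀ f : Polynomial ℤ, Commute (Polynomial.aeval s f) t := by
    intro f
    induction f using Polynomial.induction_on' with
    | add f g hf hg => rw [map_add]; exact hf.add_left hg
    | monomial k c =>
      rw [Polynomial.aeval_monomial]
      exact Commute.mul_left (Algebra.commutes c t) (hst.pow_left k)
  let φ : Polynomial (Polynomial ℤ) →+* R :=
    Polynomial.eval₂RingHom' (Polynomial.aeval s).toRingHom t hev
  have hs : φ (Polynomial.C Polynomial.X) = s := by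
    simp [φ, Polynomial.eval₂RingHom']
  have ht : φ Polynomial.X = t := by
    simp [φ, Polynomial.eval₂RingHom']
  have H := adlerJacobi_eq_zero (Polynomial.C (Polynomial.X : Polynomial ℤ)) Polynomial.X
    n m l p q r
  rw [adlerJacobi, finsum_eq_sum_of_support_subset (s := Finset.Icc lo hi),
    finsum_eq_sum_of_support_subset (s := Finset.Icc lo hi),
    finsum_eq_sum_of_support_subset (s := Finset.Icc lo hi), ← Finset.sum_sub_distrib,
    ← Finset.sum_sub_distrib] at H
  · have := congrArg φ H
    rw [map_sum, map_zero] at this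
    rw [← this]
    refine Finset.sum_congr rfl fun x _ => ?_
    rw [mul_comm (adlerKernel (Polynomial.C _) _ _ _ _)]
    simp only [map_sub, map_mul, map_adlerKernel, map_add, hs, ht]
  all_goals
    intro x hx
    by_contra hc
    rw [Finset.coe_Icc, Set.mem_Icc, not_and_or, not_le, not_le] at hc
    refine hx ?_
    simp only
    rcases hc with hc | hc
  · rw [adlerKernel_eq_zero (n := x) _ (by omega), zero_mul]
  · rw [adlerKernel_eq_zero (p := x) _ (by omega), mul_zero]
  · rw [adlerKernel_eq_zero (m := x) _ (by omega), zero_mul]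
  · rw [adlerKernel_eq_zero (q := x) _ (by omega), mul_zero]
  · rw [adlerKernel_eq_zero (n := x) _ (by omega), mul_zero]
  · rw [adlerKernel_eq_zero (q := x) _ (by omega), zero_mul]

section Generators

variable {F V : Type*} [Field F] [Ring V] [Algebra F V] {d : NCDerivation F V}

theorem snd_tmul (x y : V) : d.snd (x ⊗ₜ[F] y) = x ⊗ₜ[F] d.toLinearMap y := by
  simp [NCDerivation.snd]

variable {B : LambdaBracket d} {a : ℤ → V} {N : ℤ}

open LambdaBracket

theorem skewOp_varAdd_snd (p : PolynomialModule F (V ⊗[F] V)) :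
    skewOp d (varAdd d.snd p) = (-varAdd d.snd) (skewOp d p) := by
  have h : ∀ x, d.snd (d.tensor x) = d.tensor (d.snd x) := by
    intro x
    induction x using TensorProduct.induction_on with
    | zero => simp only [map_zero]
    | add x z hx hz => simp only [map_add, hx, hz]
    | tmul u v => simp only [NCDerivation.tensor_tmul, snd_tmul, map_add]
  have h' : ∀ x, (TensorProduct.comm F V V).toLinearMap ((d.tensor - d.snd) x) =
      d.snd ((TensorProduct.comm F V V).toLinearMap x) := by
    intro x
    induction x using TensorProduct.induction_on with
    | zero => simp only [map_zero]
    | add x z hx hz => simp only [map_add, hx, hz]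
    | tmul u v =>
      simp [NCDerivation.tensor_tmul, snd_tmul]
  rw [skewOp_apply, skewSubst_varAdd h, LinearMap.neg_apply, map_neg, map_varAdd h', skewOp_apply,
    LinearMap.neg_apply, map_neg]

/-- The exchange of `n` and `m` together with `λ+∂₂ ↦ -λ-∂₂` is the symmetry `adlerKernel_neg`. -/
theorem IsAdlerFamily.skew (h : IsAdlerFamily B a N) (p q : ℤ) :
    B.br (a p) (a q) = skewOp d (B.br (a q) (a p)) := by
  rw [h.br_eq p q _ _ subset_rfl subset_rfl, add_comm p q, h.br_eq q p _ _ subset_rfl subset_rfl,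
    Finset.sum_comm, map_sum]
  refine Finset.sum_congr rfl fun n _ => ?_
  rw [map_sum]
  refine Finset.sum_congr rfl fun m _ => ?_
  rw [apply_adlerKernel_of_comm skewOp_varAdd_snd, adlerKernel_neg, skewOp_apply,
    skewSubst_single_zero, PolynomialModule.map_single, map_neg, LinearMap.neg_apply, neg_neg]
  rfl

/-- The derivation of the second factor of `V ⊗ V ⊗ V`. -/
def NCDerivation.midThree (d : NCDerivation F V) : Module.End F (V ⊗[F] (V ⊗[F] V)) :=
  TensorProduct.map LinearMap.id (TensorProduct.map d.toLinearMap LinearMap.id)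

/-- The derivation of the third factor of `V ⊗ V ⊗ V`. -/
def NCDerivation.lastThree (d : NCDerivation F V) : Module.End F (V ⊗[F] (V ⊗[F] V)) :=
  TensorProduct.map LinearMap.id d.snd

theorem midThree_tmul (x y z : V) : d.midThree (x ⊗ₜ[F] (y ⊗ₜ[F] z)) =
    x ⊗ₜ[F] (d.toLinearMap y ⊗ₜ[F] z) := by
  simp [NCDerivation.midThree]

theorem lastThree_tmul (x y z : V) : d.lastThree (x ⊗ₜ[F] (y ⊗ₜ[F] z)) =
    x ⊗ₜ[F] (y ⊗ₜ[F] d.toLinearMap z) := by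
  simp [NCDerivation.lastThree, snd_tmul]

theorem sndThird_eq : d.sndThird = d.midThree + d.lastThree := by
  ext x y z
  simp [NCDerivation.sndThird, midThree_tmul, lastThree_tmul, NCDerivation.tensor_tmul,
    TensorProduct.tmul_add]

theorem commute_lam_mu : Commute (lamAdd d.midThree) (muAdd d.lastThree) := by
  refine LinearMap.ext fun p => ?_
  have h : ∀ x, d.midThree (d.lastThree x) = d.lastThree (d.midThree x) := by
    refine fun x => LinearMap.congr_fun (f := d.midThree ∘ₗ d.lastThree)
      (g := d.lastThree ∘ₗ d.midThree) ?_ x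
    ext x y z
    simp [midThree_tmul, lastThree_tmul]
  rw [Module.End.mul_apply, Module.End.mul_apply]
  simp only [lamAdd, muAdd, LinearMap.add_apply, map_add, mulLam_mulMu, mapTwo_mulLam,
    mapTwo_mulMu, mapTwo_comm h]
  abel

theorem lam_add_mu : lamAdd d.midThree + muAdd d.lastThree =
    mulLam F _ + mulMu F _ + mapTwo d.sndThird := by
  rw [sndThird_eq, mapTwo_add, lamAdd, muAdd]
  abel

theorem map_brL_varAdd_snd (x : V) (p : PolynomialModule F (V ⊗[F] V)) :
    PolynomialModule.map F (B.brL x) (varAdd d.snd p) =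
      muAdd d.lastThree (PolynomialModule.map F (B.brL x) p) := by
  rw [map_varAdd (D' := PolynomialModule.map F d.lastThree)]
  · rfl
  · intro y
    induction y using TensorProduct.induction_on with
    | zero => simp only [map_zero]
    | add y z hy hz => simp only [map_add, hy, hz]
    | tmul u v =>
      rw [snd_tmul, brL_tmul, brL_tmul, polyMap_map]
      congr 2
      ext s t
      simp [appendRight_tmul, lastThree_tmul]

theorem single_varAdd (D : Module.End F (V ⊗[F] (V ⊗[F] V)))
    (p : PolynomialModule F (V ⊗[F] (V ⊗[F] V))) :
    PolynomialModule.lsingle F 0 (varAdd D p) = lamAdd D (PolynomialModule.lsingle F 0 p) := by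
  rw [varAdd_apply, map_add, lamAdd, LinearMap.add_apply, mulLam, mapTwo, lsingle_eq_single,
    lsingle_eq_single, lsingle_eq_single, PolynomialModule.map_single, PolynomialModule.map_single]

theorem appendRight_varAdd_snd (y : V) (p : PolynomialModule F (V ⊗[F] V)) :
    PolynomialModule.map F (appendRight F V y) (varAdd d.snd p) =
      varAdd d.midThree (PolynomialModule.map F (appendRight F V y) p) := by
  refine map_varAdd (fun x => ?_) p
  induction x using TensorProduct.induction_on with
  | zero => simp only [map_zero]
  | add y z hy hz => simp only [map_add, hy, hz]
  | tmul u v => simp only [snd_tmul, appendRight_tmul, midThree_tmul]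

theorem mk_varAdd_snd (y : V) (p : PolynomialModule F (V ⊗[F] V)) :
    PolynomialModule.map F (TensorProduct.mk F V (V ⊗[F] V) y) (varAdd d.snd p) =
      varAdd d.lastThree (PolynomialModule.map F (TensorProduct.mk F V (V ⊗[F] V) y) p) := by
  refine map_varAdd (fun x => ?_) p
  simp [NCDerivation.lastThree]

theorem subst_brR_varAdd_snd (y : V) (p : PolynomialModule F (V ⊗[F] V)) :
    subst (mulLam F _) (inclMu F _ ∘ₗ B.brR y) (varAdd d.snd p) =
      (lamAdd d.midThree + muAdd d.lastThree)
        (subst (mulLam F _) (inclMu F _ ∘ₗ B.brR y) p) := by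
  rw [lam_add_mu, add_assoc, ← muAdd, subst_varAdd (D' := muAdd d.sndThird) _ (muAdd_mulLam _)]
  intro x
  rw [LinearMap.comp_apply, LinearMap.comp_apply, ← inclMu_varAdd]
  congr 1
  induction x using TensorProduct.induction_on with
  | zero => simp only [map_zero]
  | add y z hy hz => simp only [map_add, hy, hz]
  | tmul u v =>
    rw [snd_tmul, brR_tmul, brR_tmul, B.sesqui_right]
    exact map_varAdd (fun x => by simp [NCDerivation.sndThird]) _

theorem subst_brOuterL_varAdd_snd (c : V) (p : PolynomialModule F (V ⊗[F] V)) :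
    subst (mulLam F _) (evalLamAddMu F _ ∘ₗ B.brOuterL c) (varAdd d.snd p) =
      lamAdd d.midThree (subst (mulLam F _) (evalLamAddMu F _ ∘ₗ B.brOuterL c) p) := by
  refine subst_varAdd (fun x => ?_) (mapTwo_mulLam _) p
  rw [LinearMap.comp_apply, LinearMap.comp_apply, ← evalLamAddMu_map]
  congr 1
  induction x using TensorProduct.induction_on with
  | zero => simp only [map_zero]
  | add y z hy hz => simp only [map_add, hy, hz]
  | tmul u v =>
    rw [snd_tmul, brOuterL_tmul, brOuterL_tmul, arrow_apply_comm]
    intro x y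
    induction x using TensorProduct.induction_on with
    | zero => simp only [map_zero, LinearMap.zero_apply]
    | add y z hy hz => simp only [map_add, LinearMap.add_apply, hy, hz]
    | tmul u v => simp only [insertMid_tmul, midThree_tmul]

theorem sndThird_insertMid (x : V ⊗[F] V) (y : V) : d.sndThird (insertMid F V x y) =
    insertMid F V (d.snd x) y + insertMid F V x (d.toLinearMap y) := by
  induction x using TensorProduct.induction_on with
  | zero => simp only [map_zero, LinearMap.zero_apply, add_zero]
  | add x z hx hz => simp only [map_add, LinearMap.add_apply, hx, hz]; abel
  | tmul u v =>
    simp only [insertMid_tmul, sndThird_eq, LinearMap.add_apply, midThree_tmul, lastThree_tmul,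
      snd_tmul]
    abel

theorem eval_arrow_varAdd_snd (y : V) (p : PolynomialModule F (V ⊗[F] V)) :
    evalLamAddMu F _ (arrow d.toLinearMap (insertMid F V) (varAdd d.snd p) y) =
      (lamAdd d.midThree + muAdd d.lastThree)
        (evalLamAddMu F _ (arrow d.toLinearMap (insertMid F V) p y)) := by
  rw [arrow_varAdd sndThird_insertMid, varAdd_apply, map_add, evalLamAddMu_mulVar,
    evalLamAddMu_map, lam_add_mu]
  rfl

/-- Each of the three nested brackets of generators is a composition of two divided difference
operators, so that the Jacobi identity becomes the Yang-Baxter equation for these operators. -/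
theorem IsAdlerFamily.jacobi (h : IsAdlerFamily B a N) (p q r : ℤ) :
    B.jacobiator (a p) (a q) (a r) = 0 := by
  set s := lamAdd d.midThree with hs
  set t := muAdd d.lastThree with ht
  -- The intermediate index `x` runs over `[lo, hi]`, and the indices `n`, `m`, `l` of the tensor
  -- factors over `[lo', N]`: outside of these ranges the kernels or the coefficients vanish.
  obtain ⟨lo, hlo1, hlo2, hlo3⟩ : ∃ lo : ℤ, lo ≤ q + r + 1 - N ∧ lo ≤ p + r + 1 - N ∧
    lo ≤ p + q + 1 - N := ⟨min (q + r + 1 - N) (min (p + r + 1 - N) (p + q + 1 - N)), by omega⟩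
  obtain ⟨hi, hhi0, hhi1, hhi2, hhi3⟩ : ∃ hi : ℤ, N ≤ hi ∧ N + N - 1 - p ≤ hi ∧
    N + N - 1 - q ≤ hi ∧ N + N - 1 - r ≤ hi :=
      ⟨max N (max (N + N - 1 - p) (max (N + N - 1 - q) (N + N - 1 - r))), by omega⟩
  obtain ⟨lo', h0, h1, h2, h3⟩ : ∃ lo' : ℤ, lo' ≤ lo ∧ lo' ≤ p + lo + 1 - N ∧
    lo' ≤ q + lo + 1 - N ∧ lo' ≤ lo + r + 1 - N :=
      ⟨min lo (min (p + lo + 1 - N) (min (q + lo + 1 - N) (lo + r + 1 - N))), by omega⟩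
  set X := Finset.Icc lo hi with hX
  set K := Finset.Icc lo' N with hK
  set w : ℤ → ℤ → ℤ → PolynomialModule F (PolynomialModule F (V ⊗[F] (V ⊗[F] V))) :=
    fun n m l => constTwo (a n ⊗ₜ[F] (a m ⊗ₜ[F] a l)) with hw
  have T1 : B.nestedL (a p) (a q) (a r) = ∑ x ∈ X, ∑ l ∈ K, ∑ n ∈ K, ∑ m ∈ K,
      (adlerKernel t x l q r * adlerKernel s n m p x) (w n m l) := by
    rw [nestedL, h.br_eq q r X K (Finset.Icc_subset_Icc (by omega) (by omega))
      (Finset.Icc_subset_Icc (by omega) (by omega)), map_sum]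
    refine Finset.sum_congr rfl fun x hx => ?_
    rw [hX, Finset.mem_Icc] at hx
    rw [map_sum]
    refine Finset.sum_congr rfl fun l _ => ?_
    rw [apply_adlerKernel_of_comm (map_brL_varAdd_snd (a p)), PolynomialModule.map_single,
      brL_tmul, h.br_eq p x K K (Finset.Icc_subset_Icc (by omega) (by omega))
        (Finset.Icc_subset_Icc (by omega) (by omega)), ← lsingle_eq_single]
    simp only [map_sum]
    refine Finset.sum_congr rfl fun n _ => Finset.sum_congr rfl fun m _ => ?_
    rw [apply_adlerKernel_of_comm (appendRight_varAdd_snd (a l)),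
      apply_adlerKernel_of_comm (single_varAdd d.midThree), Module.End.mul_apply,
      PolynomialModule.map_single, appendRight_tmul]
    rfl
  have T2 : subst (mulLam F _) (inclMu F _ ∘ₗ B.brR (a q)) (B.br (a p) (a r)) =
      ∑ n ∈ K, ∑ x ∈ X, ∑ m ∈ K, ∑ l ∈ K,
      (adlerKernel (s + t) n x p r * adlerKernel t m l q x) (w n m l) := by
    rw [h.br_eq p r K X (Finset.Icc_subset_Icc (by omega) (by omega))
      (Finset.Icc_subset_Icc (by omega) (by omega)), map_sum]
    refine Finset.sum_congr rfl fun n _ => ?_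
    rw [map_sum]
    refine Finset.sum_congr rfl fun x hx => ?_
    rw [hX, Finset.mem_Icc] at hx
    rw [apply_adlerKernel_of_comm (subst_brR_varAdd_snd (a q)), subst_single_zero,
      LinearMap.comp_apply, brR_tmul,
      h.br_eq q x K K (Finset.Icc_subset_Icc (by omega) (by omega))
        (Finset.Icc_subset_Icc (by omega) (by omega))]
    simp only [map_sum]
    refine Finset.sum_congr rfl fun m _ => Finset.sum_congr rfl fun l _ => ?_
    rw [apply_adlerKernel_of_comm (mk_varAdd_snd (a n)),
      apply_adlerKernel_of_comm (inclMu_varAdd d.lastThree), Module.End.mul_apply,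
      PolynomialModule.map_single, inclMu_single]
    rfl
  have T3 : subst (mulLam F _) (evalLamAddMu F _ ∘ₗ B.brOuterL (a r)) (B.br (a p) (a q)) =
      ∑ x ∈ X, ∑ m ∈ K, ∑ n ∈ K, ∑ l ∈ K,
      (adlerKernel s x m p q * adlerKernel (s + t) n l x r) (w n m l) := by
    rw [h.br_eq p q X K (Finset.Icc_subset_Icc (by omega) (by omega))
      (Finset.Icc_subset_Icc (by omega) (by omega)), map_sum]
    refine Finset.sum_congr rfl fun x hx => ?_
    rw [hX, Finset.mem_Icc] at hx
    rw [map_sum]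
    refine Finset.sum_congr rfl fun m _ => ?_
    rw [apply_adlerKernel_of_comm (subst_brOuterL_varAdd_snd (a r)), subst_single_zero,
      LinearMap.comp_apply, brOuterL_tmul,
      h.br_eq x r K K (Finset.Icc_subset_Icc (by omega) (by omega))
        (Finset.Icc_subset_Icc (by omega) (by omega))]
    simp only [map_sum, LinearMap.sum_apply]
    refine Finset.sum_congr rfl fun n _ => Finset.sum_congr rfl fun l _ => ?_
    have e := apply_adlerKernel_of_comm
      (f := evalLamAddMu F _ ∘ₗ (arrow d.toLinearMap (insertMid F V)).flip (a m))
      (eval_arrow_varAdd_snd (d := d) (a m)) n l x r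
      (PolynomialModule.single F 0 (a n ⊗ₜ[F] a l))
    rw [Module.End.mul_apply]
    congr 1
    refine e.trans (congrArg _ ?_)
    rw [LinearMap.comp_apply, LinearMap.flip_apply, arrow_single, pow_zero, Module.End.one_apply,
      PolynomialModule.map_single, insertMid_tmul, evalLamAddMu_single]
  have R1 : B.nestedL (a p) (a q) (a r) = ∑ n ∈ K, ∑ m ∈ K, ∑ l ∈ K, ∑ x ∈ X,
      (adlerKernel t x l q r * adlerKernel s n m p x) (w n m l) := by
    rw [T1, Finset.sum_comm_cycle]
    refine Finset.sum_congr rfl fun n _ => ?_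
    rw [Finset.sum_comm_cycle]
    exact Finset.sum_congr rfl fun m _ => Finset.sum_comm
  have R2 : subst (mulLam F _) (inclMu F _ ∘ₗ B.brR (a q)) (B.br (a p) (a r)) =
      ∑ n ∈ K, ∑ m ∈ K, ∑ l ∈ K, ∑ x ∈ X,
      (adlerKernel (s + t) n x p r * adlerKernel t m l q x) (w n m l) := by
    rw [T2]
    refine Finset.sum_congr rfl fun n _ => ?_
    rw [Finset.sum_comm]
    exact Finset.sum_congr rfl fun m _ => Finset.sum_comm
  have R3 : subst (mulLam F _) (evalLamAddMu F _ ∘ₗ B.brOuterL (a r)) (B.br (a p) (a q)) =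
      ∑ n ∈ K, ∑ m ∈ K, ∑ l ∈ K, ∑ x ∈ X,
      (adlerKernel s x m p q * adlerKernel (s + t) n l x r) (w n m l) := by
    rw [T3, Finset.sum_comm_cycle]
    refine Finset.sum_congr rfl fun n _ => ?_
    rw [Finset.sum_comm]
    exact Finset.sum_congr rfl fun m _ => Finset.sum_comm
  rw [jacobiator, R1, R2, R3]
  simp only [← Finset.sum_sub_distrib]
  refine Finset.sum_eq_zero fun n hn => Finset.sum_eq_zero fun m hm =>
    Finset.sum_eq_zero fun l hl => ?_
  rw [hK, Finset.mem_Icc] at hn hm hl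
  simp only [← LinearMap.sub_apply]
  rw [← LinearMap.sum_apply, hX, sum_adlerKernel_jacobi commute_lam_mu n m l p q r lo hi
    (by omega) (by omega) (by omega) (by omega) (by omega) (by omega), LinearMap.zero_apply]

end Generators

/-! ### Restriction to a differential subalgebra -/

section Restriction

variable {F V W : Type*} [Field F] [Ring V] [Algebra F V] [Ring W] [Algebra F W]

/-- The map `W ⊗ W → V ⊗ V` induced by `i : W → V`. -/
def inclTensor (i : W →ₐ[F] V) : W ⊗[F] W →ₗ[F] V ⊗[F] V :=
  TensorProduct.map i.toLinearMap i.toLinearMap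

/-- The map `(W ⊗ W)[λ] → (V ⊗ V)[λ]` induced by `i : W → V`. -/
def inclPoly (i : W →ₐ[F] V) : PolynomialModule F (W ⊗[F] W) →ₗ[F] PolynomialModule F (V ⊗[F] V) :=
  PolynomialModule.map F (inclTensor i)

theorem inclTensor_tmul (i : W →ₐ[F] V) (x y : W) : inclTensor i (x ⊗ₜ[F] y) = i x ⊗ₜ[F] i y := rfl

variable {i : W →ₐ[F] V}

theorem inclPoly_injective (hi : Function.Injective i) : Function.Injective (inclPoly i) :=
  polyMap_injective (TensorProduct.map_injective_of_flat_flat _ _ hi hi)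

theorem inclPoly_mulVar (p : PolynomialModule F (W ⊗[F] W)) :
    inclPoly i (mulVar F _ p) = mulVar F _ (inclPoly i p) := map_mulVar _ p

theorem inclPoly_outerRight (c : W) (p : PolynomialModule F (W ⊗[F] W)) :
    inclPoly i (PolynomialModule.map F (outerRight F W c) p) =
      PolynomialModule.map F (outerRight F V (i c)) (inclPoly i p) := by
  refine polyMap_comm (fun x => ?_) p
  induction x using TensorProduct.induction_on with
  | zero => simp only [map_zero]
  | add x z hx hz => simp only [map_add, hx, hz]
  | tmul u v => simp [outerRight, inclTensor_tmul]

theorem inclPoly_outerLeft (c : W) (p : PolynomialModule F (W ⊗[F] W)) :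
    inclPoly i (PolynomialModule.map F (outerLeft F W c) p) =
      PolynomialModule.map F (outerLeft F V (i c)) (inclPoly i p) := by
  refine polyMap_comm (fun x => ?_) p
  induction x using TensorProduct.induction_on with
  | zero => simp only [map_zero]
  | add x z hx hz => simp only [map_add, hx, hz]
  | tmul u v => simp [outerLeft, inclTensor_tmul]

section Derivation

variable {d : NCDerivation F V} {d' : NCDerivation F W}

theorem inclTensor_tensor (hd : ∀ x, i (d'.toLinearMap x) = d.toLinearMap (i x))
    (x : W ⊗[F] W) :
    inclTensor i (d'.tensor x) = d.tensor (inclTensor i x) := by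
  induction x using TensorProduct.induction_on with
  | zero => simp only [map_zero]
  | add x z hx hz => simp only [map_add, hx, hz]
  | tmul u v => simp only [NCDerivation.tensor_tmul, map_add, inclTensor_tmul, hd]

theorem inclTensor_snd (hd : ∀ x, i (d'.toLinearMap x) = d.toLinearMap (i x))
    (x : W ⊗[F] W) :
    inclTensor i (d'.snd x) = d.snd (inclTensor i x) := by
  induction x using TensorProduct.induction_on with
  | zero => simp only [map_zero]
  | add x z hx hz => simp only [map_add, hx, hz]
  | tmul u v => simp only [snd_tmul, inclTensor_tmul, hd]

theorem inclPoly_varAdd_tensor (hd : ∀ x, i (d'.toLinearMap x) = d.toLinearMap (i x))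
    (p : PolynomialModule F (W ⊗[F] W)) :
    inclPoly i (varAdd d'.tensor p) = varAdd d.tensor (inclPoly i p) :=
  map_varAdd (inclTensor_tensor hd) p

theorem inclPoly_varAdd_snd (hd : ∀ x, i (d'.toLinearMap x) = d.toLinearMap (i x))
    (p : PolynomialModule F (W ⊗[F] W)) :
    inclPoly i (varAdd d'.snd p) = varAdd d.snd (inclPoly i p) :=
  map_varAdd (inclTensor_snd hd) p

theorem inclPoly_arrow_right (hd : ∀ x, i (d'.toLinearMap x) = d.toLinearMap (i x))
    (p : PolynomialModule F (W ⊗[F] W)) (c : W) :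
    inclPoly i (arrow d'.toLinearMap (starOneRight F W) p c) =
      arrow d.toLinearMap (starOneRight F V) (inclPoly i p) (i c) := by
  refine map_arrow_of_comm (D := d'.toLinearMap) (e := i.toLinearMap) (fun x y => ?_) hd p c
  induction x using TensorProduct.induction_on with
  | zero => simp only [map_zero, LinearMap.zero_apply]
  | add x z hx hz => simp only [map_add, LinearMap.add_apply, hx, hz]
  | tmul u v => simp [starOneRight_tmul, inclTensor_tmul]

theorem inclPoly_arrow_left (hd : ∀ x, i (d'.toLinearMap x) = d.toLinearMap (i x))
    (p : PolynomialModule F (W ⊗[F] W)) (c : W) :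
    inclPoly i (arrow d'.toLinearMap (starOneLeft F W) p c) =
      arrow d.toLinearMap (starOneLeft F V) (inclPoly i p) (i c) := by
  refine map_arrow_of_comm (D := d'.toLinearMap) (e := i.toLinearMap) (fun x y => ?_) hd p c
  induction x using TensorProduct.induction_on with
  | zero => simp only [map_zero, LinearMap.zero_apply]
  | add x z hx hz => simp only [map_add, LinearMap.add_apply, hx, hz]
  | tmul u v => simp [starOneLeft_tmul, inclTensor_tmul]

theorem inclPoly_adlerKernel (hd : ∀ x, i (d'.toLinearMap x) = d.toLinearMap (i x))
    (n m p q : ℤ) (x y : W) :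
    inclPoly i (adlerKernel (varAdd d'.snd) n m p q (PolynomialModule.single F 0 (x ⊗ₜ[F] y))) =
      adlerKernel (varAdd d.snd) n m p q (PolynomialModule.single F 0 (i x ⊗ₜ[F] i y)) := by
  rw [apply_adlerKernel_of_comm (inclPoly_varAdd_snd hd), inclPoly, PolynomialModule.map_single,
    inclTensor_tmul]

/-- The axioms of a `2`-fold `λ`-bracket pass to a differential algebra `W` embedded into `V`,
because `(W ⊗ W)[λ]` embeds into `(V ⊗ V)[λ]`. -/
theorem LambdaBracket.exists_restriction (hi : Function.Injective i)
    (hd : ∀ x, i (d'.toLinearMap x) = d.toLinearMap (i x)) (B : LambdaBracket d)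
    (hB : ∀ a b : W, B.br (i a) (i b) ∈ LinearMap.range (inclPoly i)) :
    ∃ B' : LambdaBracket d', ∀ a b, inclPoly i (B'.br a b) = B.br (i a) (i b) := by
  choose br hbr using hB
  have inj := inclPoly_injective hi
  refine ⟨{
    br := LinearMap.mk₂ F br
      (fun a b c => inj ?_) (fun r a b => inj ?_) (fun a b c => inj ?_) (fun r a b => inj ?_)
    sesqui_left := fun a b => inj ?_
    sesqui_right := fun a b => inj ?_
    leibniz_right := fun a b c => inj ?_
    leibniz_left := fun a b c => inj ?_ }, hbr⟩
  · rw [map_add, hbr, hbr, hbr, map_add, map_add, LinearMap.add_apply]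
  · rw [map_smul, hbr, hbr, map_smul, map_smul, LinearMap.smul_apply]
  · rw [map_add, hbr, hbr, hbr, map_add, map_add]
  · rw [map_smul, hbr, hbr, map_smul, map_smul]
  · simp only [LinearMap.mk₂_apply]
    rw [map_neg, inclPoly_mulVar, hbr, hbr, hd, B.sesqui_left]
  · simp only [LinearMap.mk₂_apply]
    rw [inclPoly_varAdd_tensor hd, hbr, hbr, hd, B.sesqui_right]
  · simp only [LinearMap.mk₂_apply]
    rw [map_add, inclPoly_outerRight, inclPoly_outerLeft, hbr, hbr, hbr, map_mul,
      B.leibniz_right]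
  · simp only [LinearMap.mk₂_apply]
    rw [map_add, inclPoly_arrow_right hd, inclPoly_arrow_left hd, hbr, hbr, hbr, map_mul,
      B.leibniz_left]

end Derivation

variable {d : NCDerivation F V} {d' : NCDerivation F W} {B : LambdaBracket d} {N : ℤ}

/-- A bracket that takes values in `(W ⊗ W)[λ]` on generators of `W` does so on all of `W`. -/
theorem LambdaBracket.br_mem_range {a : ℤ → W}
    (hd : ∀ x, i (d'.toLinearMap x) = d.toLinearMap (i x))
    (hgen : ∀ S : Subalgebra F W, (∀ x ∈ S, d'.toLinearMap x ∈ S) → (∀ n, a n ∈ S) → S = ⊤)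
    (hbr : ∀ p q, B.br (i (a p)) (i (a q)) ∈ LinearMap.range (inclPoly i)) (x y : W) :
    B.br (i x) (i y) ∈ LinearMap.range (inclPoly i) := by
  have key : ∀ x, (∀ n, B.br x (i (a n)) ∈ LinearMap.range (inclPoly i)) →
      ∀ y, B.br x (i y) ∈ LinearMap.range (inclPoly i) := by
    intro x hx
    let S : Subalgebra F W :=
      { carrier := {y | B.br x (i y) ∈ LinearMap.range (inclPoly i)}
        add_mem' := fun {y z} hy hz => by
          change B.br x (i (y + z)) ∈ LinearMap.range (inclPoly i)
          rw [map_add, map_add]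
          exact add_mem hy hz
        mul_mem' := fun {y z} hy hz => by
          obtain ⟨p, hp⟩ := hy
          obtain ⟨q, hq⟩ := hz
          change B.br x (i (y * z)) ∈ LinearMap.range (inclPoly i)
          rw [map_mul, B.leibniz_right, ← hp, ← hq, ← inclPoly_outerRight,
            ← inclPoly_outerLeft, ← map_add]
          exact LinearMap.mem_range_self _ _
        algebraMap_mem' := fun r => by
          change B.br x (i (algebraMap F W r)) ∈ LinearMap.range (inclPoly i)
          rw [AlgHom.commutes, B.br_algebraMap]
          exact zero_mem _ }
    have hS := hgen S (fun y hy => by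
      obtain ⟨p, hp⟩ := hy
      change B.br x (i (d'.toLinearMap y)) ∈ LinearMap.range (inclPoly i)
      rw [hd, B.sesqui_right, ← hp, ← inclPoly_varAdd_tensor hd]
      exact LinearMap.mem_range_self _ _) hx
    exact fun y => (hS ▸ Algebra.mem_top : y ∈ S)
  let S : Subalgebra F W :=
    { carrier := {x | ∀ y, B.br (i x) (i y) ∈ LinearMap.range (inclPoly i)}
      add_mem' := fun {x z} hx hz y => by
        rw [map_add, map_add]
        exact add_mem (hx y) (hz y)
      mul_mem' := fun {x z} hx hz y => by
        obtain ⟨p, hp⟩ := hx y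
        obtain ⟨q, hq⟩ := hz y
        rw [map_mul, B.leibniz_left, ← hp, ← hq, ← inclPoly_arrow_right hd,
          ← inclPoly_arrow_left hd, ← map_add]
        exact LinearMap.mem_range_self _ _
      algebraMap_mem' := fun r y => by
        rw [AlgHom.commutes, B.algebraMap_br]
        exact zero_mem _ }
  have hS := hgen S (fun x hx y => by
    obtain ⟨p, hp⟩ := hx y
    rw [hd, B.sesqui_left, ← hp, ← inclPoly_mulVar, ← map_neg]
    exact LinearMap.mem_range_self _ _) fun n => key _ (hbr n)
  exact (hS ▸ Algebra.mem_top : x ∈ S) y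

theorem IsAdlerFamily.br_mem_range {a : ℤ → W}
    (hd : ∀ x, i (d'.toLinearMap x) = d.toLinearMap (i x))
    (h : IsAdlerFamily B (fun n => i (a n)) N) (p q : ℤ) :
    B.br (i (a p)) (i (a q)) ∈ LinearMap.range (inclPoly i) := by
  rw [h.br_eq p q _ _ subset_rfl subset_rfl]
  exact sum_mem fun n _ => sum_mem fun m _ => ⟨_, inclPoly_adlerKernel hd n m p q (a n) (a m)⟩

theorem IsAdlerFamily.restrict {a : ℤ → W} (hi : Function.Injective i)
    (hd : ∀ x, i (d'.toLinearMap x) = d.toLinearMap (i x))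
    (h : IsAdlerFamily B (fun n => i (a n)) N) {B' : LambdaBracket d'}
    (hB : ∀ a b, inclPoly i (B'.br a b) = B.br (i a) (i b)) : IsAdlerFamily B' a N := by
  refine ⟨fun n hn => hi ((h.eq_zero n hn).trans (map_zero i).symm), fun p q s t hs ht => ?_⟩
  refine inclPoly_injective hi ((hB _ _).trans ?_)
  rw [h.br_eq p q s t hs ht]
  simp only [map_sum, inclPoly_adlerKernel hd]

variable {a : ℤ → V}

/-- If the elements `a n` generate `V`, then the identity for their brackets makes `V` a double
Poisson vertex algebra. -/
theorem IsAdlerFamily.isDoublePVA (h : IsAdlerFamily B a N)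
    (hgen : ∀ S : Subalgebra F V, (∀ x ∈ S, d.toLinearMap x ∈ S) → (∀ n, a n ∈ S) → S = ⊤) :
    B.IsDoublePVA where
  skew := B.skew_of_generators hgen h.skew
  jacobi x y z :=
    sub_eq_zero.1 (B.jacobi_of_generators hgen (B.skew_of_generators hgen h.skew) h.jacobi x y z)

theorem coeff_mem_coeffSubalgebra (L : PseudoDiffOp V) (n : ℤ) :
    L.coeff n ∈ coeffSubalgebra d L := by
  rw [coeffSubalgebra, Algebra.mem_sInf]
  exact fun S hS => hS.2 n

theorem coeffSubalgebra_le (L : PseudoDiffOp V) (S : Subalgebra F V)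
    (hd : ∀ x ∈ S, d.toLinearMap x ∈ S) (hS : ∀ n, L.coeff n ∈ S) : coeffSubalgebra d L ≤ S :=
  sInf_le ⟨hd, hS⟩

theorem coeffSubalgebra_eq_top (L : PseudoDiffOp V) (S : Subalgebra F (coeffSubalgebra d L))
    (hd : ∀ x ∈ S, (d.restrict _ (coeffSubalgebra_stable d L)).toLinearMap x ∈ S)
    (hS : ∀ n, (⟨L.coeff n, coeff_mem_coeffSubalgebra L n⟩ : coeffSubalgebra d L) ∈ S) :
    S = ⊤ := by
  refine eq_top_iff.2 fun x _ => ?_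
  obtain ⟨y, hy, hxy⟩ := coeffSubalgebra_le (d := d) L (S.map (coeffSubalgebra d L).val)
    (by
      rintro _ ⟨y, hy, rfl⟩
      exact ⟨_, hd y hy, rfl⟩)
    (fun n => ⟨_, hS n, rfl⟩) x.2
  rwa [← Subtype.ext hxy]

end Restriction

end DoublePVA

end

theorem mainTheorem4 {F : Type*} [Field F] [CharZero F] {V : Type*} [Ring V] [Algebra F V]
    (d : DoublePVA.NCDerivation F V) (B : DoublePVA.LambdaBracket d)
    (L : DoublePVA.PseudoDiffOp V) (hL : DoublePVA.IsAdlerType B L) :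
    ∃ B' : DoublePVA.LambdaBracket
        (d.restrict (DoublePVA.coeffSubalgebra d L) (DoublePVA.coeffSubalgebra_stable d L)),
      B.IsRestriction B' ∧ B'.IsDoublePVA := by
  obtain ⟨N, hN⟩ := L.bdd
  have h := hL.isAdlerFamily hN
  have hmem := DoublePVA.coeff_mem_coeffSubalgebra (d := d) L
  have hd : ∀ x, (DoublePVA.coeffSubalgebra d L).val
      ((d.restrict _ (DoublePVA.coeffSubalgebra_stable d L)).toLinearMap x) =
      d.toLinearMap ((DoublePVA.coeffSubalgebra d L).val x) := fun _ => rfl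
  have hgen := DoublePVA.coeffSubalgebra_eq_top (d := d) L
  obtain ⟨B', hB'⟩ := B.exists_restriction Subtype.val_injective hd
    (DoublePVA.LambdaBracket.br_mem_range hd hgen
      (DoublePVA.IsAdlerFamily.br_mem_range (a := fun n => ⟨_, hmem n⟩) hd h))
  exact ⟨B', hB', (DoublePVA.IsAdlerFamily.restrict (a := fun n => ⟨_, hmem n⟩)
    Subtype.val_injective hd h hB').isDoublePVA hgen⟩
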